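/- In the fillable array problem one maintains an array $A[0..n-1]$ with entries in $\{0,\dots,2^w-1\}$ under the operations $\mathbf{write}(i,\Delta)$, which sets $A[i]\leftarrow\Delta$, $\mathbf{fill}(\Delta)$, which sets $A[i]\leftarrow\Delta$ for all $i$, and $\mathbf{read}(i)$, which returns $A[i]$ (the answer is arbitrary if $A[i]$ has never been set). The machine is a word RAM with $w$-bit words, $w\ge 1$ and $n\le 2^w$, so that an index fits into one word; comparisons, arithmetic, bitwise operations, shifts and memory accesses take unit time, and a program has a constant number of working registers, which are not preserved from one operation to the next; the parameter $n\ge 1$ is known to the program. **Theorem.** There are a deterministic data structure for fillable arrays, given by one fixed set of programs for the initialization and the three operations, the same for all $n$ and $w$, and a constant $C$, such that the following holds for all $n, w\ge 1$ with $n\le 2^w$. The data structure uses exactly $nw+1$ bits of memory ($n$ words of $w$ bits and one further bit), that is, one bit of redundancy. It is initialized in at most $C$ steps, whatever the memory contains at the beginning. For every finite sequence of operations after the initialization, every operation terminates and every $\mathbf{read}$ of an entry that has been set returns its current value; every $\mathbf{read}$ and every $\mathbf{fill}$ takes at most $C$ steps (worst-case $O(1)$ time), and all $\mathbf{write}$ operations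 of the sequence together take at most $Ck$ steps, where $k$ is the number of writes in it (amortized $O(1)$ time per write). -/

import Mathlib

/-! # Fillable arrays on a word RAM

The machine has words of `w` bits.  The data structure owns a memory of exactly `n * w + 1` bits:
`n` words and one further bit.  Nothing else survives from one operation to the next.  While an
operation runs, the program may also use the registers that it names, a fixed finite number
of words, since registers cannot be addressed indirectly. -/

namespace FillableArray

/-- A memory of `n * w + 1` bits: `n` words of `w` bits, with addresses `0, …, n - 1`, and a
single extra bit. -/
@[ext]
structure Memory (n w : ℕ) where
  cells : Fin n → BitVec w
  bit : Bool

/-- The state of the machine while an operation runs. -/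
@[ext]
structure State (n w : ℕ) where
  regs : ℕ → BitVec w
  mem : Memory n w

/-- The arithmetic and bitwise operations of the word RAM, all on unsigned `w`-bit words; addition,
subtraction and multiplication are modulo `2 ^ w`. -/
inductive BinOp where
  | add | sub | mul | div | mod | and | or | xor | shl | shr

/-- The value of an arithmetic or bitwise operation. -/
def BinOp.eval {w : ℕ} : BinOp → BitVec w → BitVec w → BitVec w
  | .add, x, y => x + y
  | .sub, x, y => x - y
  | .mul, x, y => x * y
  | .div, x, y => x / y
  | .mod, x, y => x % y
  | .and, x, y => x &&& y
  | .or, x, y => x ||| y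
  | .xor, x, y => x ^^^ y
  | .shl, x, y => x <<< y.toNat
  | .shr, x, y => x >>> y.toNat

/-- Unit-cost instructions; all arguments but the literal in `const` are names of registers. -/
inductive Instr where
  /-- `r_d := c` (modulo `2 ^ w`) for a literal `c` -/
  | const (d c : ℕ)
  /-- `r_d := r_a` -/
  | copy (d a : ℕ)
  /-- `r_d := r_a o r_b` -/
  | binop (o : BinOp) (d a b : ℕ)
  /-- `r_d := memory[r_a]` -/
  | load (d a : ℕ)
  /-- `memory[r_a] := r_b` -/
  | store (a b : ℕ)
  /-- `r_d :=` the extra bit, as `0` or `1` -/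
  | getBit (d : ℕ)
  /-- the extra bit `:=` the least significant bit of `r_a` -/
  | putBit (a : ℕ)

/-- Assign to a register. -/
def State.setReg {n w : ℕ} (s : State n w) (d : ℕ) (v : BitVec w) : State n w :=
  { s with regs := Function.update s.regs d v }

/-- The effect of an instruction.  An access to a memory address that is `≥ n` is an error, after
which there is no next state. -/
def Instr.step {n w : ℕ} : Instr → State n w → Option (State n w)
  | .const d c, s => some (s.setReg d (BitVec.ofNat w c))
  | .copy d a, s => some (s.setReg d (s.regs a))
  | .binop o d a b, s => some (s.setReg d (o.eval (s.regs a) (s.regs b)))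
  | .load d a, s =>
      if h : (s.regs a).toNat < n then
        some (s.setReg d (s.mem.cells ⟨(s.regs a).toNat, h⟩))
      else none
  | .store a b, s =>
      if h : (s.regs a).toNat < n then
        some { s with mem :=
          { s.mem with cells := Function.update s.mem.cells ⟨(s.regs a).toNat, h⟩ (s.regs b) } }
      else none
  | .getBit d, s => some (s.setReg d (BitVec.ofNat w s.mem.bit.toNat))
  | .putBit a, s => some { s with mem := { s.mem with bit := (s.regs a).getLsbD 0 } }

/-- Tests: comparisons of two registers, as unsigned numbers. -/
inductive Test where
  | eq (a b : ℕ)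
  | lt (a b : ℕ)

/-- The outcome of a test. -/
def Test.holds {n w : ℕ} : Test → State n w → Prop
  | .eq a b, s => s.regs a = s.regs b
  | .lt a b, s => (s.regs a).toNat < (s.regs b).toNat

/-- Programs of the word RAM.  A program does not depend on `n` or `w`. -/
inductive Program where
  | instr (i : Instr)
  | seq (p q : Program)
  /-- if `c` then `p` else `q` -/
  | branch (c : Test) (p q : Program)
  /-- while `c` do `p` -/
  | loop (c : Test) (p : Program)

/-- `Exec p s t s'`: started in state `s`, the program `p` halts without error in state `s'` after
exactly `t` steps, where every instruction and every evaluation of a test is one step. -/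
inductive Exec {n w : ℕ} : Program → State n w → ℕ → State n w → Prop
  | instr {i : Instr} {s s' : State n w} :
      i.step s = some s' → Exec (.instr i) s 1 s'
  | seq {p q : Program} {s s' s'' : State n w} {t t' : ℕ} :
      Exec p s t s' → Exec q s' t' s'' → Exec (.seq p q) s (t + t') s''
  | branch_true {c : Test} {p q : Program} {s s' : State n w} {t : ℕ} :
      c.holds s → Exec p s t s' → Exec (.branch c p q) s (1 + t) s'
  | branch_false {c : Test} {p q : Program} {s s' : State n w} {t : ℕ} :
      ¬ c.holds s → Exec q s t s' → Exec (.branch c p q) s (1 + t) s'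
  | loop_true {c : Test} {p : Program} {s s' s'' : State n w} {t t' : ℕ} :
      c.holds s → Exec p s t s' → Exec (.loop c p) s' t' s'' →
        Exec (.loop c p) s (1 + t + t') s''
  | loop_false {c : Test} {p : Program} {s : State n w} :
      ¬ c.holds s → Exec (.loop c p) s 1 s

/-- Programs are deterministic: the outcome and the number of steps are determined by the
initial state. -/
theorem Exec.deterministic {n w : ℕ} {p : Program} {s s₁ s₂ : State n w} {t₁ t₂ : ℕ}
    (h₁ : Exec p s t₁ s₁) (h₂ : Exec p s t₂ s₂) : t₁ = t₂ ∧ s₁ = s₂ := by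
  induction h₁ generalizing t₂ s₂ with
  | instr h =>
    cases h₂ with
    | instr h' => exact ⟨rfl, Option.some.inj (h.symm.trans h')⟩
  | seq _ _ ih ih' =>
    cases h₂ with
    | seq a b =>
      obtain ⟨rfl, rfl⟩ := ih a
      obtain ⟨rfl, rfl⟩ := ih' b
      exact ⟨rfl, rfl⟩
  | branch_true hc _ ih =>
    cases h₂ with
    | branch_true _ a => obtain ⟨rfl, rfl⟩ := ih a; exact ⟨rfl, rfl⟩
    | branch_false hc' _ => exact absurd hc hc'
  | branch_false hc _ ih =>
    cases h₂ with
    | branch_true hc' _ => exact absurd hc' hc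
    | branch_false _ a => obtain ⟨rfl, rfl⟩ := ih a; exact ⟨rfl, rfl⟩
  | loop_true hc _ _ ih ih' =>
    cases h₂ with
    | loop_true _ a b =>
      obtain ⟨rfl, rfl⟩ := ih a
      obtain ⟨rfl, rfl⟩ := ih' b
      exact ⟨rfl, rfl⟩
    | loop_false hc' => exact absurd hc hc'
  | loop_false hc =>
    cases h₂ with
    | loop_true hc' _ _ => exact absurd hc' hc
    | loop_false _ => exact ⟨rfl, rfl⟩

/-- The operations on an array with `n` entries in `{0, …, 2 ^ w - 1}`, indexed by
`0, …, n - 1`. -/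
inductive Operation (n w : ℕ) where
  | read (i : Fin n)
  | write (i : Fin n) (Δ : BitVec w)
  | fill (Δ : BitVec w)

/-- Whether an operation is a write. -/
def Operation.isWrite {n w : ℕ} : Operation n w → Bool
  | .write _ _ => true
  | _ => false

/-- The effect of an operation on the array; `none` is an entry that has never been set. -/
def Operation.apply {n w : ℕ} :
    Operation n w → (Fin n → Option (BitVec w)) → (Fin n → Option (BitVec w))
  | .read _, A => A
  | .write i Δ, A => Function.update A i (some Δ)
  | .fill Δ, _ => fun _ => some Δ

/-- An implementation: one program for the initialization and one for each kind of operation. -/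
structure Implementation where
  init : Program
  read : Program
  write : Program
  fill : Program

/-- The state in which the program of an operation starts.  Register `0` holds `n - 1`, the largest
index; registers `1` and `2` hold the arguments of the operation (index and value, `0` if there is
none); all other registers hold `0`. -/
def startState {n w : ℕ} (m : Memory n w) (i Δ : BitVec w) : State n w where
  regs := fun r =>
    if r = 0 then BitVec.ofNat w (n - 1) else if r = 1 then i else if r = 2 then Δ else 0
  mem := m

/-- `D.InitExec m t m'`: on the memory `m`, the initialization takes `t` steps and leaves the
memory `m'`. -/
def Implementation.InitExec (D : Implementation) {n w : ℕ} (m : Memory n w) (t : ℕ)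
    (m' : Memory n w) : Prop :=
  ∃ s : State n w, Exec D.init (startState m 0 0) t s ∧ s.mem = m'

/-- The program that runs for an operation. -/
def Implementation.program (D : Implementation) {n w : ℕ} : Operation n w → Program
  | .read _ => D.read
  | .write _ _ => D.write
  | .fill _ => D.fill

/-- The state in which an operation starts on the memory `m`. -/
def Operation.start {n w : ℕ} : Operation n w → Memory n w → State n w
  | .read i, m => startState m (BitVec.ofNat w i) 0
  | .write i Δ, m => startState m (BitVec.ofNat w i) Δ
  | .fill Δ, m => startState m 0 Δ

/-- An executed operation, with the word that it returned and the number of steps that it took.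
(The word returned by a write or a fill has no meaning.) -/
structure Event (n w : ℕ) where
  op : Operation n w
  ret : BitVec w
  time : ℕ

/-- `D.Run m es m'`: started on the memory `m`, the implementation `D` executes the operations
recorded in `es` one after the other and leaves the memory `m'`.  Only the memory is handed from
one operation to the next; the returned word is the final content of register `0`. -/
inductive Implementation.Run (D : Implementation) {n w : ℕ} :
    Memory n w → List (Event n w) → Memory n w → Prop
  | nil {m : Memory n w} : D.Run m [] m
  | cons {m m' : Memory n w} {op : Operation n w} {t : ℕ} {s : State n w}
      {es : List (Event n w)} :
      Exec (D.program op) (op.start m) t s → D.Run s.mem es m' →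
        D.Run m (⟨op, s.regs 0, t⟩ :: es) m'

/-- `Correct A es`: if the array is `A` at the beginning, every read in the sequence `es` returns
the current entry, provided that this entry has been set. -/
def Correct {n w : ℕ} : (Fin n → Option (BitVec w)) → List (Event n w) → Prop
  | _, [] => True
  | A, e :: es =>
      (∀ i v, e.op = .read i → A i = some v → e.ret = v) ∧ Correct (e.op.apply A) es

/-- The number of writes in a sequence. -/
def numWrites {n w : ℕ} (es : List (Event n w)) : ℕ :=
  es.countP fun e => e.op.isWrite

/-- The total number of steps taken by the writes in a sequence. -/
def writeTime {n w : ℕ} (es : List (Event n w)) : ℕ :=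
  ((es.filter fun e => e.op.isWrite).map Event.time).sum

end FillableArray

namespace FillableArray

/-! The memory is cut into `N = (n - 1) / 4` blocks of four words; the one to four words behind the
blocks are always stored as they are. If the extra bit is set, the blocks are stored as they are
too. Otherwise there are a boundary `b < N` and the value `Δ` of the last fill. By default a block
on the left of `b` holds its own data, while a block on the right contains garbage and stands for
four copies of `Δ`. The exceptions are pairs of a left and a right block whose words 0 point to each
other: the left one then stands for `Δ`, and the data of the right one lie in words 1 to 3 of the
left block and word 3 of the right block. Words 1 and 2 of right blocks are never needed, so the
last block, which is a right block as long as `b < N`, has room for `b` and `Δ`. Four is the least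
block size that leaves these two words free.

Since pointers must be mutual, garbage is harmless. A fill only sets `b = 0`, where no link exists,
and stores the value. When a left block is overwritten by arbitrary data, it may by accident form a
link with a right block; letting that right block point to itself destroys the link
(`link_setPlain`).

Every write moves the boundary by one block. Block `b` becomes plain, and this yields a spare left
block that is free and represents `Δ`: the former partner of `b`, or `b` itself if it had none
(`wp_extend`). One spare block is all that a write needs. A linked left target hands its right
partner over to the spare (`wp_relocate`), and a right target is stored together with the spare
(`Rep.setLink`). When the boundary reaches `N`, all blocks are plain (`Rep.eq`) and the bit is set.

No program contains a loop, so every operation, including each single write, takes at most as many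
steps as its program has instructions and tests. The proof separates the effect of pure block
operations on `Rep` from a weakest precondition calculus showing that the programs perform these
operations; `wp_operation` and `exists_run` put both together. -/

/-! ### The pure data structure -/

/-- Blocks `i` (on the left of the boundary `b`) and `j` (on its right) point to each other. -/
def Link {w : ℕ} (N b : ℕ) (B : ℕ → Fin 4 → BitVec w) (i j : ℕ) : Prop :=
  i < b ∧ b ≤ j ∧ j < N ∧ (B i 0).toNat = j ∧ (B j 0).toNat = i

/-- The blocks `B` represent the blocks `V`, where `b` is the boundary and `Δ` the last value
that was filled in. -/
structure Rep {w : ℕ} (N b : ℕ) (Δ : BitVec w) (B V : ℕ → Fin 4 → BitVec w) : Prop where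
  left_linked : ∀ i j, Link N b B i j → V i = fun _ => Δ
  right_linked : ∀ i j, Link N b B i j → V j = ![B i 1, B i 2, B i 3, B j 3]
  left_free : ∀ i, i < b → (∀ j, ¬ Link N b B i j) → V i = B i
  right_free : ∀ j, b ≤ j → j < N → (∀ i, ¬ Link N b B i j) → V j = fun _ => Δ
  tail : ∀ k, N ≤ k → V k = B k

open Classical in
/-- The right block that is linked to the left block `i`, or `i` itself. -/
noncomputable def rightPartner {w : ℕ} (N b : ℕ) (B : ℕ → Fin 4 → BitVec w) (i : ℕ) : ℕ :=
  if Link N b B i (B i 0).toNat then (B i 0).toNat else i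

open Classical in
/-- The left block that is linked to the right block `j`, or `j` itself. -/
noncomputable def leftPartner {w : ℕ} (N b : ℕ) (B : ℕ → Fin 4 → BitVec w) (j : ℕ) : ℕ :=
  if Link N b B (B j 0).toNat j then (B j 0).toNat else j

open Classical in
/-- Write `d` into the left block `i` and make sure that `i` is not linked afterwards. -/
noncomputable def setPlain {w : ℕ} (N b : ℕ) (B : ℕ → Fin 4 → BitVec w) (i : ℕ)
    (d : Fin 4 → BitVec w) : ℕ → Fin 4 → BitVec w :=
  if Link N b (Function.update B i d) i (d 0).toNat then
    Function.update (Function.update B i d) (d 0).toNat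
      (Function.update (B (d 0).toNat) 0 (d 0))
  else Function.update B i d

/-- Store the data `d` of the right block `j` in the linked blocks `i` and `j`. -/
def setLink {w : ℕ} (B : ℕ → Fin 4 → BitVec w) (i j : ℕ)
    (d : Fin 4 → BitVec w) : ℕ → Fin 4 → BitVec w :=
  Function.update (Function.update B i ![BitVec.ofNat w j, d 0, d 1, d 2]) j
    ![BitVec.ofNat w i, B j 1, B j 2, d 3]

/-! ### Effect of the block operations on the links and on the represented array. -/

section

variable {w N b : ℕ} {Δ : BitVec w} {B V : ℕ → Fin 4 → BitVec w}

theorem Link.right_unique {i j j' : ℕ} (h : Link N b B i j) (h' : Link N b B i j') : j = j' :=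
  h.2.2.2.1.symm.trans h'.2.2.2.1

theorem Link.left_unique {i i' j : ℕ} (h : Link N b B i j) (h' : Link N b B i' j) : i = i' :=
  h.2.2.2.2.symm.trans h'.2.2.2.2

theorem setPlain_self {i : ℕ} (hi : i < b) (d : Fin 4 → BitVec w) : setPlain N b B i d i = d := by
  unfold setPlain
  split_ifs with h
  · have : i ≠ (d 0).toNat := by have := h.2.1; omega
    simp [Function.update_of_ne this]
  · simp

theorem setPlain_of_ne {i k : ℕ} (hk : k ≠ i) (d : Fin 4 → BitVec w) {c : Fin 4} (hc : c ≠ 0) :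
    setPlain N b B i d k c = B k c := by
  unfold setPlain
  split_ifs with h
  · rw [Function.update_apply]
    split_ifs with h'
    · subst h'; simp [Function.update_of_ne hc]
    · simp [Function.update_of_ne hk]
  · simp [Function.update_of_ne hk]

theorem setPlain_left {i k : ℕ} (hk : k ≠ i) (d : Fin 4 → BitVec w) (hb : k < b) :
    setPlain N b B i d k = B k := by
  unfold setPlain
  split_ifs with h
  · have : k ≠ (d 0).toNat := by have := h.2.1; omega
    simp [Function.update_of_ne this, Function.update_of_ne hk]
  · simp [Function.update_of_ne hk]

theorem setPlain_tail {i k : ℕ} (hk : k ≠ i) (d : Fin 4 → BitVec w) (hN : N ≤ k) :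
    setPlain N b B i d k = B k := by
  unfold setPlain
  split_ifs with h
  · have : k ≠ (d 0).toNat := by have := h.2.2.1; omega
    simp [Function.update_of_ne this, Function.update_of_ne hk]
  · simp [Function.update_of_ne hk]

/-- The repair destroys no other link: the right block that it changes pointed to `i`, so `i` was
its only possible partner. Afterwards this block points to itself, which is not a left block, so it
is unlinked. -/
theorem link_setPlain {i : ℕ} (hi : i < b) (d : Fin 4 → BitVec w) (i' j' : ℕ) :
    Link N b (setPlain N b B i d) i' j' ↔ i' ≠ i ∧ Link N b B i' j' := by
  by_cases h : Link N b (Function.update B i d) i (d 0).toNat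
  · have e : setPlain N b B i d = Function.update (Function.update B i d) (d 0).toNat
      (Function.update (B (d 0).toNat) 0 (d 0)) := by simp [setPlain, h]
    obtain ⟨-, h1, h2, -, h3⟩ := h
    have hne : (d 0).toNat ≠ i := by omega
    rw [Function.update_of_ne hne] at h3
    rw [e]
    unfold Link
    simp only [Function.update_apply]
    by_cases h5 : i' < b
    · by_cases h6 : b ≤ j'
      · have h7 : i' ≠ (d 0).toNat := by omega
        have h8 : j' ≠ i := by omega
        by_cases h9 : i' = i
        · subst h9
          simp only [hne.symm, if_true, if_false, h8]
          by_cases h10 : j' = (d 0).toNat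
          · subst h10; simp; omega
          · simp [Ne.symm h10]
        · by_cases h10 : j' = (d 0).toNat
          · subst h10; simp [h7, h9, h3]; omega
          · simp [h7, h8, h9, h10]
      · simp [h6]
    · simp [h5]
  · have e : setPlain N b B i d = Function.update B i d := by simp [setPlain, h]
    rw [e]
    by_cases h9 : i' = i
    · subst h9
      simp only [ne_eq, not_true_eq_false, false_and, iff_false]
      intro h'
      apply h
      have := h'.2.2.2.1
      simp only [Function.update_self] at this
      rwa [this]
    · simp only [ne_eq, h9, not_false_eq_true, true_and]
      unfold Link
      by_cases h6 : b ≤ j'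
      · have h8 : j' ≠ i := by omega
        simp [Function.update_of_ne h8, Function.update_of_ne h9]
      · simp [h6]

theorem rightPartner_of_link {i j : ℕ} (h : Link N b B i j) : rightPartner N b B i = j := by
  have := h.2.2.2.1
  subst this
  simp [rightPartner, h]

theorem leftPartner_of_link {i j : ℕ} (h : Link N b B i j) : leftPartner N b B j = i := by
  have := h.2.2.2.2
  subst this
  simp [leftPartner, h]

theorem rightPartner_cases (i : ℕ) :
    Link N b B i (rightPartner N b B i) ∨
      rightPartner N b B i = i ∧ ∀ j, ¬ Link N b B i j := by
  by_cases h : ∃ j, Link N b B i j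
  · obtain ⟨j, h⟩ := h
    left; rwa [rightPartner_of_link h]
  · right
    push Not at h
    exact ⟨by simp [rightPartner, h], h⟩

theorem leftPartner_cases (j : ℕ) :
    Link N b B (leftPartner N b B j) j ∨
      leftPartner N b B j = j ∧ ∀ i, ¬ Link N b B i j := by
  by_cases h : ∃ i, Link N b B i j
  · obtain ⟨i, h⟩ := h
    left; rwa [leftPartner_of_link h]
  · right
    push Not at h
    exact ⟨by simp [leftPartner, h], h⟩

/-- Overwriting a free left block. -/
theorem Rep.setPlain_free (h : Rep N b Δ B V) {i : ℕ} (hi : i < b)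
    (hb : b ≤ N) (hl : ∀ j, ¬ Link N b B i j) (d : Fin 4 → BitVec w) :
    Rep N b Δ (setPlain N b B i d) (Function.update V i d) where
  left_linked i' j' h' := by
    rw [link_setPlain hi] at h'
    rw [Function.update_of_ne h'.1, h.left_linked i' j' h'.2]
  right_linked i' j' h' := by
    rw [link_setPlain hi] at h'
    have hj : j' ≠ i := by have := h'.2.2.1; omega
    rw [Function.update_of_ne hj, h.right_linked i' j' h'.2]
    simp [setPlain_of_ne h'.1, setPlain_of_ne hj]
  left_free i' hi' h' := by
    by_cases e : i' = i
    · subst e; simp [setPlain_self hi]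
    · rw [Function.update_of_ne e, setPlain_left e _ hi']
      refine h.left_free i' hi' fun j hj => h' j ?_
      rw [link_setPlain hi]; exact ⟨e, hj⟩
  right_free j' hb hj' h' := by
    have hj : j' ≠ i := by omega
    rw [Function.update_of_ne hj]
    refine h.right_free j' hb hj' fun i' hi' => h' i' ?_
    rw [link_setPlain hi]
    -- Freeness of `i` matters here: a right partner of `i` would lose its data and fall back to
    -- `Δ`.
    refine ⟨?_, hi'⟩
    rintro rfl
    exact hl _ hi'
  tail k hk := by
    have e : k ≠ i := by omega
    rw [Function.update_of_ne e, setPlain_tail e _ hk, h.tail k hk]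

/-- Detaching a right block from its left partner. -/
theorem Rep.setPlain_linked (h : Rep N b Δ B V) {i j : ℕ} (hij : Link N b B i j) :
    Rep N b Δ (setPlain N b B i fun _ => Δ) (Function.update V j fun _ => Δ) where
  left_linked i' j' h' := by
    rw [link_setPlain hij.1] at h'
    have : i' ≠ j := by have := h'.2.1; have := hij.2.1; omega
    rw [Function.update_of_ne this, h.left_linked i' j' h'.2]
  right_linked i' j' h' := by
    rw [link_setPlain hij.1] at h'
    have hj : j' ≠ i := by have := h'.2.2.1; have := hij.1; omega
    have hj' : j' ≠ j := by
      rintro rfl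
      exact h'.1 (h'.2.left_unique hij)
    rw [Function.update_of_ne hj', h.right_linked i' j' h'.2]
    simp [setPlain_of_ne h'.1, setPlain_of_ne hj]
  left_free i' hi' h' := by
    have hj : i' ≠ j := by have := hij.2.1; omega
    rw [Function.update_of_ne hj]
    -- Being linked, `i` already represented `Δ`; storing `Δ` plainly keeps its value, and only `j`
    -- loses data.
    by_cases e : i' = i
    · subst e; rw [setPlain_self hi', h.left_linked _ _ hij]
    · rw [setPlain_left e _ hi']
      refine h.left_free i' hi' fun j hj => h' j ?_
      rw [link_setPlain hij.1]; exact ⟨e, hj⟩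
  right_free j' hb hj' h' := by
    by_cases e : j' = j
    · subst e; simp
    · rw [Function.update_of_ne e]
      refine h.right_free j' hb hj' fun i' hi' => h' i' ?_
      rw [link_setPlain hij.1]
      refine ⟨?_, hi'⟩
      rintro rfl
      exact e (hi'.right_unique hij)
  tail k hk := by
    have h1 := hij.1
    have h2 := hij.2.1
    have h3 := hij.2.2.1
    rw [Function.update_of_ne (by omega), setPlain_tail (by omega) _ hk, h.tail k hk]

/-- If block `b` is free, its change of sides destroys no link. It can create links only with `b` as
the left end, and `setPlain` removes those. -/
theorem link_succ (hb : ∀ i, ¬ Link N b B i b) {i j : ℕ} (hi : i ≠ b) :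
    Link N (b + 1) B i j ↔ Link N b B i j := by
  constructor
  · rintro ⟨h1, h2, h3⟩
    exact ⟨by omega, by omega, h3⟩
  · intro h
    have : j ≠ b := by rintro rfl; exact hb _ h
    obtain ⟨h1, h2, h3⟩ := h
    exact ⟨by omega, by omega, h3⟩

/-- Moving the boundary past a free block. -/
theorem Rep.extend (h : Rep N b Δ B V) (hbN : b < N) (hl : ∀ i, ¬ Link N b B i b)
    (d : Fin 4 → BitVec w) :
    Rep N (b + 1) Δ (setPlain N (b + 1) B b d) (Function.update V b d) where
  left_linked i' j' h' := by
    rw [link_setPlain (Nat.lt_succ_self b)] at h'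
    rw [link_succ hl h'.1] at h'
    rw [Function.update_of_ne h'.1, h.left_linked i' j' h'.2]
  right_linked i' j' h' := by
    rw [link_setPlain (Nat.lt_succ_self b)] at h'
    have hj : j' ≠ b := by have := h'.2.2.1; omega
    rw [link_succ hl h'.1] at h'
    rw [Function.update_of_ne hj, h.right_linked i' j' h'.2]
    simp [setPlain_of_ne h'.1, setPlain_of_ne hj]
  left_free i' hi' h' := by
    by_cases e : i' = b
    · subst e; simp [setPlain_self hi']
    · rw [Function.update_of_ne e, setPlain_left e _ hi']
      refine h.left_free i' (by omega) fun j hj => h' j ?_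
      rw [link_setPlain (Nat.lt_succ_self b), link_succ hl e]; exact ⟨e, hj⟩
  right_free j' hb hj' h' := by
    have hj : j' ≠ b := by omega
    rw [Function.update_of_ne hj]
    refine h.right_free j' (by omega) hj' fun i' hi' => h' i' ?_
    have e : i' ≠ b := by have := hi'.1; omega
    rw [link_setPlain (Nat.lt_succ_self b), link_succ hl e]
    exact ⟨e, hi'⟩
  tail k hk := by
    rw [Function.update_of_ne (by omega), setPlain_tail (by omega) _ hk, h.tail k hk]

/-- Both blocks are free, so overwriting their pointers destroys no link. Each of them has a single
pointer, now used for the other one, so no third block gets linked. The bound on `N` makes block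
numbers fit into a word. -/
theorem link_setLink {i j : ℕ} (hi : i < b) (hj : b ≤ j) (hjN : j < N) (hN : N ≤ 2 ^ w)
    (hli : ∀ j, ¬ Link N b B i j) (hlj : ∀ i, ¬ Link N b B i j) (d : Fin 4 → BitVec w)
    (i' j' : ℕ) :
    Link N b (setLink B i j d) i' j' ↔ (i' = i ∧ j' = j) ∨ Link N b B i' j' := by
  have hij : i ≠ j := by omega
  have e1 : (BitVec.ofNat w j).toNat = j := by
    rw [BitVec.toNat_ofNat, Nat.mod_eq_of_lt (by omega)]
  have e2 : (BitVec.ofNat w i).toNat = i := by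
    rw [BitVec.toNat_ofNat, Nat.mod_eq_of_lt (by omega)]
  have hi' := hli j'
  have hj' := hlj i'
  unfold Link setLink at *
  simp only [Function.update_apply]
  by_cases h5 : i' < b
  · by_cases h6 : b ≤ j'
    · have h7 : i' ≠ j := by omega
      have h8 : j' ≠ i := by omega
      by_cases h9 : i' = i
      · subst h9
        by_cases h10 : j' = j
        · subst h10; simp [h7, e1, e2]; omega
        · simp only [h7, h10, h8, if_true, if_false]
          simp only [hi', and_false, or_false, iff_false]
          simp [e1, Ne.symm h10]
      · by_cases h10 : j' = j
        · subst h10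
          simp only [h7, h9, if_true, if_false]
          simp only [hj', false_and, or_false, iff_false]
          simp [e2, Ne.symm h9]
        · simp [h7, h8, h9, h10]
    · simp [h6]; omega
  · simp [h5]; omega

/-- Giving a free right block a free left partner, to store the data `d`. -/
theorem Rep.setLink (h : Rep N b Δ B V) {i j : ℕ} (hi : i < b) (hj : b ≤ j) (hjN : j < N)
    (hN : N ≤ 2 ^ w) (hli : ∀ j, ¬ Link N b B i j) (hlj : ∀ i, ¬ Link N b B i j)
    (hV : V i = fun _ => Δ) (d : Fin 4 → BitVec w) :
    Rep N b Δ (FillableArray.setLink B i j d) (Function.update V j d) := by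
  have hL := link_setLink hi hj hjN hN hli hlj d
  have hij : i ≠ j := by omega
  have hBi : FillableArray.setLink B i j d i = ![BitVec.ofNat w j, d 0, d 1, d 2] := by
    simp [FillableArray.setLink, Function.update_of_ne hij]
  have hBj : FillableArray.setLink B i j d j = ![BitVec.ofNat w i, B j 1, B j 2, d 3] := by
    simp [FillableArray.setLink]
  have hB : ∀ k, k ≠ i → k ≠ j → FillableArray.setLink B i j d k = B k := by
    intro k h1 h2
    simp [FillableArray.setLink, Function.update_of_ne h1, Function.update_of_ne h2]
  refine ⟨?_, ?_, ?_, ?_, fun k hk => by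
    rw [Function.update_of_ne (by omega), hB k (by omega) (by omega), h.tail k hk]⟩
  · intro i' j' h'
    rw [hL] at h'
    obtain ⟨rfl, rfl⟩ | h' := h'
    · rw [Function.update_of_ne hij, hV]
    · have : i' ≠ j := by have := h'.1; omega
      rw [Function.update_of_ne this, h.left_linked i' j' h']
  · intro i' j' h'
    rw [hL] at h'
    obtain ⟨rfl, rfl⟩ | h' := h'
    · rw [hBi, hBj, Function.update_self]
      ext1 c; fin_cases c <;> rfl
    · have e1 : i' ≠ i := by rintro rfl; exact hli _ h'
      have e2 : j' ≠ j := by rintro rfl; exact hlj _ h'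
      have e3 : i' ≠ j := by have := h'.1; omega
      have e4 : j' ≠ i := by have := h'.2.1; omega
      rw [Function.update_of_ne e2, h.right_linked i' j' h', hB i' e1 e3, hB j' e4 e2]
  · intro i' hi' h'
    have e1 : i' ≠ i := by
      rintro rfl; exact h' j ((hL _ _).2 (Or.inl ⟨rfl, rfl⟩))
    have e3 : i' ≠ j := by omega
    rw [Function.update_of_ne e3, hB i' e1 e3]
    exact h.left_free i' hi' fun j' hj' => h' j' ((hL _ _).2 (Or.inr hj'))
  · intro j' hb hj' h'
    have e1 : j' ≠ j := by
      rintro rfl; exact h' i ((hL _ _).2 (Or.inl ⟨rfl, rfl⟩))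
    rw [Function.update_of_ne e1]
    exact h.right_free j' hb hj' fun i' hi' => h' i' ((hL _ _).2 (Or.inr hi'))

/-- After a fill, no block is on the left of the boundary. -/
theorem Rep.fill (hV : ∀ k < N, V k = fun _ => Δ) (hB : ∀ k, N ≤ k → V k = B k) :
    Rep N 0 Δ B V where
  left_linked i _ h := absurd h.1 (Nat.not_lt_zero i)
  right_linked i _ h := absurd h.1 (Nat.not_lt_zero i)
  left_free i h := absurd h (Nat.not_lt_zero i)
  right_free j _ hj _ := hV j hj
  tail := hB

/-- When all blocks are on the left of the boundary, they are stored as they are. -/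
theorem Rep.eq (h : Rep N N Δ B V) : V = B := by
  funext k
  by_cases hk : k < N
  · exact h.left_free k hk fun j hj => by
      have h1 := hj.2.1
      have h2 := hj.2.2.1
      omega
  · exact h.tail k (by omega)

/-- A representation depends only on the words that may hold data or links. -/
theorem Rep.congr (h : Rep N b Δ B V) {B' V' : ℕ → Fin 4 → BitVec w} (hb : b ≤ N)
    (hB : ∀ k < N, ∀ c, (b ≤ k → c ≠ 1 ∧ c ≠ 2) → B' k c = B k c)
    (hV : ∀ k < N, V' k = V k) (hT : ∀ k, N ≤ k → V' k = B' k) : Rep N b Δ B' V' := by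
  have hL : ∀ i j, Link N b B' i j ↔ Link N b B i j := by
    intro i j
    unfold Link
    constructor
    · rintro ⟨h1, h2, h3, h4, h5⟩
      rw [hB _ (by omega) _ (by simp)] at h4 h5
      exact ⟨h1, h2, h3, h4, h5⟩
    · rintro ⟨h1, h2, h3, h4, h5⟩
      rw [← hB _ (by omega) _ (by simp)] at h4 h5
      exact ⟨h1, h2, h3, h4, h5⟩
  refine ⟨?_, ?_, ?_, ?_, hT⟩
  · intro i j hij
    have := hij.1
    rw [hV i (by omega), h.left_linked i j ((hL i j).1 hij)]
  · intro i j hij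
    have h1 := hij.1
    have h2 := hij.2.1
    have h3 := hij.2.2.1
    rw [hV j (by omega), h.right_linked i j ((hL i j).1 hij)]
    rw [hB i (by omega) 1 (by omega), hB i (by omega) 2 (by omega), hB i (by omega) 3 (by omega),
      hB j (by omega) 3 (by simp)]
  · intro i hi h'
    rw [hV i (by omega), h.left_free i hi fun j hj => h' j ((hL i j).2 hj)]
    ext1 c
    rw [hB i (by omega) c (by omega)]
  · intro j h1 h2 h'
    rw [hV j h2, h.right_free j h1 h2 fun i hi => h' i ((hL i j).2 hi)]

/-- A change beyond the blocks. -/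
theorem Rep.update_tail (h : Rep N b Δ B V) {k : ℕ} (hb : b ≤ N) (hk : N ≤ k)
    (d : Fin 4 → BitVec w) : Rep N b Δ (Function.update B k d) (Function.update V k d) := by
  have hB : ∀ i < N, Function.update B k d i = B i := fun i hi =>
    Function.update_of_ne (by omega) _ _
  refine h.congr hb (fun i hi c _ => by rw [hB i hi])
    (fun i hi => Function.update_of_ne (by omega) _ _) fun i hi => ?_
  by_cases e : i = k
  · subst e; simp
  · rw [Function.update_of_ne e, Function.update_of_ne e, h.tail i hi]

end

/-! ### Weakest preconditions -/

infixr:60 " ;; " => Program.seq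

/-- The number of instructions and tests in a program. -/
def Program.size : Program → ℕ
  | .instr _ => 1
  | .seq p q => p.size + q.size
  | .branch _ p q => 1 + p.size + q.size
  | .loop _ p => 1 + p.size

/-- Started in `s`, the program `p` runs without reaching a loop and ends in a state that
satisfies `Q`. -/
def wp {n w : ℕ} : Program → (State n w → Prop) → State n w → Prop
  | .instr i, Q, s => ∃ s', i.step s = some s' ∧ Q s'
  | .seq p q, Q, s => wp p (wp q Q) s
  | .branch c p q, Q, s => (c.holds s → wp p Q s) ∧ (¬ c.holds s → wp q Q s)
  | .loop _ _, _, _ => False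

/-- `wp` is false on loops, so each instruction and each test of the program is executed at most
once. All time bounds come from this lemma. -/
theorem exists_exec_of_wp {n w : ℕ} (p : Program) {Q : State n w → Prop} {s : State n w}
    (h : wp p Q s) : ∃ t s', Exec p s t s' ∧ t ≤ p.size ∧ Q s' := by
  induction p generalizing Q s with
  | instr i =>
    obtain ⟨s', h1, h2⟩ := h
    exact ⟨1, s', .instr h1, le_rfl, h2⟩
  | seq p q ihp ihq =>
    obtain ⟨t, s', h1, h2, h3⟩ := ihp h
    obtain ⟨t', s'', h4, h5, h6⟩ := ihq h3
    exact ⟨t + t', s'', .seq h1 h4, by simp only [Program.size]; omega, h6⟩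
  | branch c p q ihp ihq =>
    by_cases hc : c.holds s
    · obtain ⟨t, s', h1, h2, h3⟩ := ihp (h.1 hc)
      exact ⟨1 + t, s', .branch_true hc h1, by simp only [Program.size]; omega, h3⟩
    · obtain ⟨t, s', h1, h2, h3⟩ := ihq (h.2 hc)
      exact ⟨1 + t, s', .branch_false hc h1, by simp only [Program.size]; omega, h3⟩
  | loop c p _ => exact h.elim

theorem wp_mono {n w : ℕ} (p : Program) {Q R : State n w → Prop} {s : State n w}
    (h : wp p Q s) (hQR : ∀ s, Q s → R s) : wp p R s := by
  induction p generalizing Q R s with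
  | instr i =>
    obtain ⟨s', h1, h2⟩ := h
    exact ⟨s', h1, hQR _ h2⟩
  | seq p q ihp ihq => exact ihp h fun s hs => ihq hs hQR
  | branch c p q ihp ihq => exact ⟨fun hc => ihp (h.1 hc) hQR, fun hc => ihq (h.2 hc) hQR⟩
  | loop c p _ => exact h.elim

/-- Word `c` of block `k`. -/
def Memory.word {n w : ℕ} (m : Memory n w) (k : ℕ) (c : Fin 4) : BitVec w :=
  -- Addresses beyond the memory get `0`, so that the blocks form a total function as in `Rep`;
  -- programs only access addresses below `n`.
  if h : 4 * k + c < n then m.cells ⟨4 * k + c, h⟩ else 0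

section

variable {n w : ℕ} {Q : State n w → Prop} {s : State n w}

theorem wp_seq {p q : Program} : wp (p ;; q) Q s ↔ wp p (wp q Q) s := Iff.rfl

theorem wp_branch {c : Test} {p q : Program} :
    wp (.branch c p q) Q s ↔ (c.holds s → wp p Q s) ∧ (¬ c.holds s → wp q Q s) := Iff.rfl

theorem wp_const {d c : ℕ} :
    wp (.instr (.const d c)) Q s ↔ Q (s.setReg d (BitVec.ofNat w c)) := by
  simp [wp, Instr.step]

theorem wp_copy {d a : ℕ} : wp (.instr (.copy d a)) Q s ↔ Q (s.setReg d (s.regs a)) := by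
  simp [wp, Instr.step]

theorem wp_binop {o : BinOp} {d a b : ℕ} :
    wp (.instr (.binop o d a b)) Q s ↔ Q (s.setReg d (o.eval (s.regs a) (s.regs b))) := by
  simp [wp, Instr.step]

theorem wp_getBit {d : ℕ} :
    wp (.instr (.getBit d)) Q s ↔ Q (s.setReg d (BitVec.ofNat w s.mem.bit.toNat)) := by
  simp [wp, Instr.step]

theorem wp_putBit {a : ℕ} :
    wp (.instr (.putBit a)) Q s ↔
      Q { s with mem := { s.mem with bit := (s.regs a).getLsbD 0 } } := by
  simp [wp, Instr.step]

theorem wp_load {d a k : ℕ} {c : Fin 4} (ha : (s.regs a).toNat = 4 * k + c)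
    (hlt : 4 * k + c < n) :
    wp (.instr (.load d a)) Q s ↔ Q (s.setReg d (s.mem.word k c)) := by
  simp [wp, Instr.step, ha, hlt, Memory.word]

/-- The new state is described only by its registers, its bit and its words, which hides the
addresses in `Fin n` from later proofs. -/
theorem wp_store {a b k : ℕ} {c : Fin 4} (ha : (s.regs a).toNat = 4 * k + c)
    (hlt : 4 * k + c < n)
    (H : ∀ s' : State n w, s'.regs = s.regs → s'.mem.bit = s.mem.bit →
      s'.mem.word = Function.update s.mem.word k
        (Function.update (s.mem.word k) c (s.regs b)) → Q s') :
    wp (.instr (.store a b)) Q s := by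
  simp only [wp, Instr.step, ha, hlt, dite_true, Option.some.injEq, exists_eq_left']
  apply H
  · rfl
  · rfl
  · funext k' c'
    simp only [Memory.word, Function.update_apply, Fin.mk.injEq]
    by_cases hk : k' = k
    · subst hk
      by_cases hc : c' = c
      · subst hc; simp [hlt]
      · have : (c' : ℕ) ≠ c := fun h => hc (Fin.ext h)
        simp [hc, this, Memory.word]
    · have : ¬ 4 * k' + (c' : ℕ) = 4 * k + c := by omega
      simp [hk, this, Memory.word]

@[simp] theorem setReg_regs (d r : ℕ) (v : BitVec w) :
    (s.setReg d v).regs r = if r = d then v else s.regs r := by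
  simp [State.setReg, Function.update_apply]

@[simp] theorem setReg_mem (d : ℕ) (v : BitVec w) : (s.setReg d v).mem = s.mem := rfl

end

/-! ### Access to blocks -/

/-- Compute the address of word `c` of the block given by register `p`. -/
def address (p : ℕ) (c : Fin 4) : Program :=
  .instr (.const 30 4) ;; .instr (.binop .mul 30 30 p) ;; .instr (.const 31 c) ;;
    .instr (.binop .add 30 30 31)

/-- Load word `c` of the block given by register `p` into register `d`. -/
def getWord (d p : ℕ) (c : Fin 4) : Program := address p c ;; .instr (.load d 30)

/-- Store register `a` in word `c` of the block given by register `p`. -/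
def putWord (p : ℕ) (c : Fin 4) (a : ℕ) : Program := address p c ;; .instr (.store 30 a)

/-- Register `30` is scratch space, outside all frame conditions. -/
def skip : Program := .instr (.copy 30 30)

section

variable {n w : ℕ} {Q : State n w → Prop} {s : State n w}

theorem wp_skip (H : ∀ s' : State n w, s'.mem = s.mem →
      (∀ r < 30, s'.regs r = s.regs r) → Q s') : wp skip Q s := by
  rw [skip, wp_copy]
  exact H _ rfl fun r hr => by simp [show r ≠ 30 by omega]

theorem wp_address {p k : ℕ} {c : Fin 4} (hw : 3 ≤ w) (hn : n ≤ 2 ^ w) (hp : p < 30)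
    (hk : (s.regs p).toNat = k) (hlt : 4 * k + c < n)
    (H : ∀ s' : State n w, s'.mem = s.mem → (s'.regs 30).toNat = 4 * k + c →
      (∀ r < 30, s'.regs r = s.regs r) → Q s') :
    wp (address p c) Q s := by
  simp only [address, wp_seq, wp_const, wp_binop]
  apply H
  · rfl
  · have h8 : 2 ^ 3 ≤ 2 ^ w := Nat.pow_le_pow_right (by norm_num) hw
    have hc := c.isLt
    have e1 : (4 : ℕ) % 2 ^ w = 4 := Nat.mod_eq_of_lt (by omega)
    have e2 : (c : ℕ) % 2 ^ w = c := Nat.mod_eq_of_lt (by omega)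
    have e3 : (4 * k) % 2 ^ w = 4 * k := Nat.mod_eq_of_lt (by omega)
    have e4 : (4 * k + c) % 2 ^ w = 4 * k + c := Nat.mod_eq_of_lt (by omega)
    simp [BinOp.eval, show p ≠ 30 by omega, hk, BitVec.toNat_add, BitVec.toNat_mul, e4]
  · intro r hr
    simp [show r ≠ 30 by omega, show r ≠ 31 by omega]

theorem wp_getWord {d p k : ℕ} {c : Fin 4} (hw : 3 ≤ w) (hn : n ≤ 2 ^ w) (hp : p < 30)
    (hk : (s.regs p).toNat = k) (hlt : 4 * k + c < n)
    (H : ∀ s' : State n w, s'.mem = s.mem → s'.regs d = s.mem.word k c →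
      (∀ r < 30, r ≠ d → s'.regs r = s.regs r) → Q s') :
    wp (getWord d p c) Q s := by
  rw [getWord, wp_seq]
  refine wp_address hw hn hp hk hlt fun s' h1 h2 h3 => ?_
  rw [wp_load h2 hlt]
  apply H
  · simp [h1]
  · simp [h1]
  · intro r hr hd
    simp [hd, h3 r hr]

theorem wp_putWord {a p k : ℕ} {c : Fin 4} (hw : 3 ≤ w) (hn : n ≤ 2 ^ w) (hp : p < 30)
    (ha : a < 30) (hk : (s.regs p).toNat = k) (hlt : 4 * k + c < n)
    (H : ∀ s' : State n w, s'.mem.bit = s.mem.bit →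
      s'.mem.word = Function.update s.mem.word k
        (Function.update (s.mem.word k) c (s.regs a)) →
      (∀ r < 30, s'.regs r = s.regs r) → Q s') :
    wp (putWord p c a) Q s := by
  rw [putWord, wp_seq]
  refine wp_address hw hn hp hk hlt fun s' h1 h2 h3 => ?_
  refine wp_store h2 hlt fun s'' h4 h5 h6 => ?_
  apply H
  · rw [h5, h1]
  · rw [h6, h1, h3 a ha]
  · intro r hr
    rw [h4, h3 r hr]

end

/-! ### Procedures

Register `3` holds the number of blocks, register `4` the boundary, register `5` the value of the
last fill, and registers `10` to `13` hold the content of a block.  The registers from `20` on are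
for local use. -/

/-- In register `J`, compute the right block linked to the left block `I`, or `I` itself. -/
def findRight (I J : ℕ) : Program :=
  getWord J I 0 ;;
    .branch (.lt J 4) (.instr (.copy J I))
      (.branch (.lt J 3)
        (getWord 20 J 0 ;; .branch (.eq 20 I) skip (.instr (.copy J I)))
        (.instr (.copy J I)))

/-- In register `P`, compute the left block linked to the right block `J`, or `J` itself. -/
def findLeft (J P : ℕ) : Program :=
  getWord P J 0 ;;
    .branch (.lt P 4)
      (getWord 20 P 0 ;; .branch (.eq 20 J) skip (.instr (.copy P J)))
      (.instr (.copy P J))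

/-- Load the data of the right block `J`, and its left partner into register `P`. -/
def loadRight (J P : ℕ) : Program :=
  findLeft J P ;;
    .branch (.eq P J)
      (.instr (.copy 10 5) ;; .instr (.copy 11 5) ;; .instr (.copy 12 5) ;; .instr (.copy 13 5))
      (getWord 10 P 1 ;; getWord 11 P 2 ;; getWord 12 P 3 ;; getWord 13 J 3)

/-- Write the four given registers into the left block `I`, and unlink it. -/
def plainBlock (I e₀ e₁ e₂ e₃ : ℕ) : Program :=
  putWord I 0 e₀ ;; putWord I 1 e₁ ;; putWord I 2 e₂ ;; putWord I 3 e₃ ;;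
    findRight I 21 ;; .branch (.eq 21 I) skip (putWord 21 0 21)

/-- Link the left block `F` and the right block `J`, and store the data of `J`. -/
def linkBlocks (F J : ℕ) : Program :=
  putWord F 0 J ;; putWord F 1 10 ;; putWord F 2 11 ;; putWord F 3 12 ;;
    putWord J 0 F ;; putWord J 3 13

/-- Load the left block `I`, as it is. -/
def loadPlain (I : ℕ) : Program :=
  getWord 10 I 0 ;; getWord 11 I 1 ;; getWord 12 I 2 ;; getWord 13 I 3

/-- Load the data of the right block `J`, and unlink it from its left partner, which is put into
register `P`. -/
def detach (J P : ℕ) : Program :=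
  loadRight J P ;; .branch (.eq P J) skip (plainBlock P 5 5 5 5)

/-- Replace the data word whose number is in register `8` by the word in register `2`. -/
def changeWord : Program :=
  .instr (.const 20 0) ;; .branch (.eq 8 20) (.instr (.copy 10 2))
    (.instr (.const 20 1) ;; .branch (.eq 8 20) (.instr (.copy 11 2))
      (.instr (.const 20 2) ;; .branch (.eq 8 20) (.instr (.copy 12 2)) (.instr (.copy 13 2))))

/-- The content of registers `10` to `13`. -/
def State.data {n w : ℕ} (s : State n w) : Fin 4 → BitVec w :=
  ![s.regs 10, s.regs 11, s.regs 12, s.regs 13]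

/-- What the registers `3`, `4` and `5` hold. -/
structure Context {n w : ℕ} (N b : ℕ) (Δ : BitVec w) (s : State n w) : Prop where
  three_le : 3 ≤ w
  le_pow : n ≤ 2 ^ w
  lt : 4 * N < n
  le : b ≤ N
  reg3 : (s.regs 3).toNat = N
  reg4 : (s.regs 4).toNat = b
  reg5 : s.regs 5 = Δ

/-! ### The procedures carry out the block operations. -/

section

variable {n w N b : ℕ} {Δ : BitVec w} {Q : State n w → Prop} {s : State n w}

theorem Context.of_regs (h : Context N b Δ s) {s' : State n w} (h3 : s'.regs 3 = s.regs 3)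
    (h4 : s'.regs 4 = s.regs 4) (h5 : s'.regs 5 = s.regs 5) : Context N b Δ s' :=
  ⟨h.1, h.2, h.3, h.4, by rw [h3, h.5], by rw [h4, h.6], by rw [h5, h.7]⟩

theorem Context.address_lt (h : Context N b Δ s) {k : ℕ} (hk : k < N) (c : Fin 4) :
    4 * k + (c : ℕ) < n := by
  have := h.lt
  have := c.isLt
  omega

theorem eq_iff_toNat {x y : BitVec w} : x = y ↔ x.toNat = y.toNat :=
  ⟨fun h => by rw [h], BitVec.eq_of_toNat_eq⟩

/-- The pointer may be garbage, so it is compared with `N` before it is followed; hence no load is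
out of range. Returning `I` itself for a missing partner is unambiguous, because partners lie on
opposite sides of the boundary. -/
theorem wp_findRight (h : Context N b Δ s) {I J i : ℕ} (hI : I < 20) (hJ : J < 30)
    (hJ' : J ≠ 20 ∧ J ≠ 3 ∧ J ≠ 4) (hIJ : I ≠ J) (hi : (s.regs I).toNat = i) (hib : i < b)
    (H : ∀ s' : State n w, s'.mem = s.mem →
      (s'.regs J).toNat = rightPartner N b s.mem.word i →
      (∀ r < 20, r ≠ J → s'.regs r = s.regs r) → Q s') :
    wp (findRight I J) Q s := by
  have hbN := h.le
  rw [findRight, wp_seq]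
  refine wp_getWord h.1 h.2 (by omega) hi (h.address_lt (by omega) 0) fun s₁ m₁ r₁ f₁ => ?_
  have e3 : (s₁.regs 3).toNat = N := by rw [f₁ 3 (by norm_num) (by omega), h.reg3]
  have e4 : (s₁.regs 4).toNat = b := by rw [f₁ 4 (by norm_num) (by omega), h.reg4]
  have eI : (s₁.regs I).toNat = i := by rw [f₁ I (by omega) hIJ, hi]
  have fail : ∀ s' : State n w, s'.mem = s.mem → (∀ r < 20, r ≠ J → s'.regs r = s.regs r) →
      ¬ Link N b s.mem.word i (s.mem.word i 0).toNat → Q (s'.setReg J (s'.regs I)) := by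
    intro s' m' f' hl
    apply H
    · simpa using m'
    · simp [rightPartner, hl, f' I hI hIJ, hi]
    · intro r hr hrJ
      simp [hrJ, f' r hr hrJ]
  have f₁' : ∀ r < 20, r ≠ J → s₁.regs r = s.regs r := fun r hr hrJ => f₁ r (by omega) hrJ
  rw [wp_branch]
  refine ⟨fun hc => ?_, fun hc => ?_⟩
  · rw [wp_copy]
    refine fail s₁ m₁ f₁' fun hl => ?_
    have h2 := hl.2.1
    simp only [Test.holds, r₁, e4] at hc
    omega
  simp only [Test.holds, r₁, e4, not_lt] at hc
  rw [wp_branch]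
  refine ⟨fun hc' => ?_, fun hc' => ?_⟩
  · simp only [Test.holds, r₁, e3] at hc'
    rw [wp_seq]
    refine wp_getWord h.1 h.2 hJ (by rw [r₁]) (h.address_lt hc' 0) fun s₂ m₂ r₂ f₂ => ?_
    have f₂' : ∀ r < 20, r ≠ J → s₂.regs r = s.regs r := fun r hr hrJ => by
      rw [f₂ r (by omega) (by omega), f₁' r hr hrJ]
    rw [wp_branch]
    refine ⟨fun hd => ?_, fun hd => ?_⟩
    · simp only [Test.holds, r₂, eq_iff_toNat, f₂' I hI hIJ, hi, m₁] at hd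
      refine wp_skip fun s₃ m₃ f₃ => ?_
      apply H
      · rw [m₃, m₂, m₁]
      · have hl : Link N b s.mem.word i (s.mem.word i 0).toNat := ⟨hib, hc, hc', rfl, hd⟩
        rw [rightPartner, if_pos hl, f₃ J hJ, f₂ J hJ hJ'.1, r₁]
      · intro r hr hrJ
        rw [f₃ r (by omega), f₂' r hr hrJ]
    · simp only [Test.holds, r₂, eq_iff_toNat, f₂' I hI hIJ, hi, m₁] at hd
      rw [wp_copy]
      exact fail s₂ (by rw [m₂, m₁]) f₂' fun hl => hd hl.2.2.2.2
  · simp only [Test.holds, r₁, e3] at hc'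
    rw [wp_copy]
    exact fail s₁ m₁ f₁' fun hl => hc' hl.2.2.1

theorem wp_findLeft (h : Context N b Δ s) {J P j : ℕ} (hJ : J < 20) (hP : P < 20)
    (hP' : P ≠ 3 ∧ P ≠ 4) (hJP : J ≠ P) (hj : (s.regs J).toNat = j)
    (hbj : b ≤ j) (hjN : j < N)
    (H : ∀ s' : State n w, s'.mem = s.mem →
      (s'.regs P).toNat = leftPartner N b s.mem.word j →
      (∀ r < 20, r ≠ P → s'.regs r = s.regs r) → Q s') :
    wp (findLeft J P) Q s := by
  rw [findLeft, wp_seq]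
  refine wp_getWord h.1 h.2 (by omega) hj (h.address_lt (by omega) 0) fun s₁ m₁ r₁ f₁ => ?_
  have e4 : (s₁.regs 4).toNat = b := by rw [f₁ 4 (by norm_num) (by omega), h.reg4]
  have fail : ∀ s' : State n w, s'.mem = s.mem → (∀ r < 20, r ≠ P → s'.regs r = s.regs r) →
      ¬ Link N b s.mem.word (s.mem.word j 0).toNat j → Q (s'.setReg P (s'.regs J)) := by
    intro s' m' f' hl
    apply H
    · simpa using m'
    · simp [leftPartner, hl, f' J hJ hJP, hj]
    · intro r hr hrJ
      simp [hrJ, f' r hr hrJ]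
  have f₁' : ∀ r < 20, r ≠ P → s₁.regs r = s.regs r := fun r hr hrJ => f₁ r (by omega) hrJ
  rw [wp_branch]
  refine ⟨fun hc => ?_, fun hc => ?_⟩
  · simp only [Test.holds, r₁, e4] at hc
    rw [wp_seq]
    refine wp_getWord h.1 h.2 (by omega) (by rw [r₁]) (h.address_lt (by omega) 0)
      fun s₂ m₂ r₂ f₂ => ?_
    have f₂' : ∀ r < 20, r ≠ P → s₂.regs r = s.regs r := fun r hr hrJ => by
      rw [f₂ r (by omega) (by omega), f₁' r hr hrJ]
    rw [wp_branch]
    refine ⟨fun hd => ?_, fun hd => ?_⟩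
    · simp only [Test.holds, r₂, eq_iff_toNat, f₂' J hJ hJP, hj, m₁] at hd
      refine wp_skip fun s₃ m₃ f₃ => ?_
      apply H
      · rw [m₃, m₂, m₁]
      · have hl : Link N b s.mem.word (s.mem.word j 0).toNat j := ⟨hc, hbj, hjN, hd, rfl⟩
        rw [leftPartner, if_pos hl, f₃ P (by omega), f₂ P (by omega) (by omega), r₁]
      · intro r hr hrJ
        rw [f₃ r (by omega), f₂' r hr hrJ]
    · simp only [Test.holds, r₂, eq_iff_toNat, f₂' J hJ hJP, hj, m₁] at hd
      rw [wp_copy]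
      exact fail s₂ (by rw [m₂, m₁]) f₂' fun hl => hd hl.2.2.2.1
  · simp only [Test.holds, r₁, e4] at hc
    rw [wp_copy]
    exact fail s₁ m₁ f₁' fun hl => hc hl.1

theorem wp_loadRight (h : Context N b Δ s) {V : ℕ → Fin 4 → BitVec w}
    (hR : Rep N b Δ s.mem.word V) {J P j : ℕ} (hJ : J < 10 ∨ 14 ≤ J ∧ J < 20)
    (hP : 14 ≤ P ∧ P < 20)
    (hJP : J ≠ P) (hj : (s.regs J).toNat = j) (hbj : b ≤ j) (hjN : j < N)
    (H : ∀ s' : State n w, s'.mem = s.mem →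
      (s'.regs P).toNat = leftPartner N b s.mem.word j → s'.data = V j →
      (∀ r < 20, r ≠ P → r < 10 ∨ 14 ≤ r → s'.regs r = s.regs r) → Q s') :
    wp (loadRight J P) Q s := by
  have hbN := h.le
  rw [loadRight, wp_seq]
  refine wp_findLeft h (by omega) (by omega) (by omega) hJP hj hbj hjN fun s₁ m₁ r₁ f₁ => ?_
  have eJ : (s₁.regs J).toNat = j := by rw [f₁ J (by omega) (by omega), hj]
  have e5 : s₁.regs 5 = Δ := by rw [f₁ 5 (by omega) (by omega), h.reg5]
  rw [wp_branch]
  simp only [Test.holds, eq_iff_toNat, r₁, eJ]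
  obtain hl | ⟨hl, hl'⟩ := leftPartner_cases (N := N) (b := b) (B := s.mem.word) j
  · have hlb := hl.1
    have hne : leftPartner N b s.mem.word j ≠ j := by omega
    refine ⟨fun hc => absurd hc hne, fun _ => ?_⟩
    have hlt : ∀ c : Fin 4, 4 * leftPartner N b s.mem.word j + (c : ℕ) < n := fun c =>
      h.address_lt (by omega) c
    rw [wp_seq]
    refine wp_getWord h.1 h.2 (by omega) r₁ (hlt 1) fun s₂ m₂ r₂ f₂ => ?_
    rw [wp_seq]
    refine wp_getWord h.1 h.2 (by omega) (by rw [f₂ P (by omega) (by omega), r₁]) (hlt 2)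
      fun s₃ m₃ r₃ f₃ => ?_
    rw [wp_seq]
    refine wp_getWord h.1 h.2 (by omega)
      (by rw [f₃ P (by omega) (by omega), f₂ P (by omega) (by omega), r₁]) (hlt 3)
      fun s₄ m₄ r₄ f₄ => ?_
    refine wp_getWord h.1 h.2 (by omega)
      (by rw [f₄ J (by omega) (by omega), f₃ J (by omega) (by omega),
        f₂ J (by omega) (by omega), eJ]) (h.address_lt hjN 3)
      fun s₅ m₅ r₅ f₅ => ?_
    apply H
    · rw [m₅, m₄, m₃, m₂, m₁]
    · rw [f₅ P (by omega) (by omega), f₄ P (by omega) (by omega), f₃ P (by omega) (by omega),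
        f₂ P (by omega) (by omega), r₁]
    · rw [hR.right_linked _ _ hl, State.data, r₅, f₅ 12 (by omega) (by omega), r₄,
        f₅ 11 (by omega) (by omega), f₄ 11 (by omega) (by omega), r₃,
        f₅ 10 (by omega) (by omega), f₄ 10 (by omega) (by omega), f₃ 10 (by omega) (by omega), r₂,
        m₄, m₃, m₂, m₁]
    · intro r hr h1 h2
      rw [f₅ r (by omega) (by omega), f₄ r (by omega) (by omega), f₃ r (by omega) (by omega),
        f₂ r (by omega) (by omega), f₁ r (by omega) (by omega)]
  · refine ⟨fun _ => ?_, fun hc => absurd hl hc⟩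
    simp only [wp_seq, wp_copy]
    apply H
    · simpa using m₁
    · simp [show P ≠ 10 by omega, show P ≠ 11 by omega, show P ≠ 12 by omega,
        show P ≠ 13 by omega, r₁]
    · rw [hR.right_free j hbj hjN hl']
      ext1 c
      fin_cases c <;> simp [State.data, e5]
    · intro r hr h1 h2
      simp [show r ≠ 10 by omega, show r ≠ 11 by omega, show r ≠ 12 by omega,
        show r ≠ 13 by omega, f₁ r hr h1]

/-- The search for a partner takes place in the memory that already contains the new data, so a
partner found is precisely the accidental link in `setPlain`. It is made to point to itself. -/
theorem wp_plainBlock (h : Context N b Δ s) {I e₀ e₁ e₂ e₃ i : ℕ} (hI : I < 20) (h₀ : e₀ < 20)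
    (h₁ : e₁ < 20) (h₂ : e₂ < 20) (h₃ : e₃ < 20) (hi : (s.regs I).toNat = i) (hib : i < b)
    (H : ∀ s' : State n w, s'.mem.bit = s.mem.bit →
      s'.mem.word = setPlain N b s.mem.word i
        ![s.regs e₀, s.regs e₁, s.regs e₂, s.regs e₃] →
      (∀ r < 20, s'.regs r = s.regs r) → Q s') :
    wp (plainBlock I e₀ e₁ e₂ e₃) Q s := by
  have hbN := h.le
  have hlt := h.address_lt (k := i) (by omega)
  rw [plainBlock, wp_seq]
  refine wp_putWord h.1 h.2 (by omega) (by omega) hi (hlt 0) fun s₁ b₁ m₁ f₁ => ?_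
  rw [wp_seq]
  refine wp_putWord h.1 h.2 (by omega) (by omega) (by rw [f₁ I (by omega), hi]) (hlt 1)
    fun s₂ b₂ m₂ f₂ => ?_
  rw [wp_seq]
  refine wp_putWord h.1 h.2 (by omega) (by omega)
    (by rw [f₂ I (by omega), f₁ I (by omega), hi]) (hlt 2) fun s₃ b₃ m₃ f₃ => ?_
  rw [wp_seq]
  refine wp_putWord h.1 h.2 (by omega) (by omega)
    (by rw [f₃ I (by omega), f₂ I (by omega), f₁ I (by omega), hi]) (hlt 3)
    fun s₄ b₄ m₄ f₄ => ?_
  have f : ∀ r < 30, s₄.regs r = s.regs r := fun r hr => by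
    rw [f₄ r hr, f₃ r hr, f₂ r hr, f₁ r hr]
  have m : s₄.mem.word = Function.update s.mem.word i
      ![s.regs e₀, s.regs e₁, s.regs e₂, s.regs e₃] := by
    rw [m₄, m₃, m₂, m₁, f₃ e₃ (by omega), f₂ e₃ (by omega), f₁ e₃ (by omega),
      f₂ e₂ (by omega), f₁ e₂ (by omega), f₁ e₁ (by omega)]
    simp only [Function.update_idem, Function.update_self]
    congr 1
    ext1 c
    fin_cases c <;> simp
  have bt : s₄.mem.bit = s.mem.bit := by rw [b₄, b₃, b₂, b₁]
  generalize hd : ![s.regs e₀, s.regs e₁, s.regs e₂, s.regs e₃] = d at m H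
  have h' : Context N b Δ s₄ := h.of_regs (f 3 (by omega)) (f 4 (by omega)) (f 5 (by omega))
  rw [wp_seq]
  refine wp_findRight h' hI (by omega) (by omega) (by omega) (by rw [f I (by omega), hi]) hib
    fun s₅ m₅ r₅ f₅ => ?_
  have eI : (s₅.regs I).toNat = i := by rw [f₅ I hI (by omega), f I (by omega), hi]
  rw [wp_branch]
  simp only [Test.holds, eq_iff_toNat, eI, r₅]
  have hd0 : s₄.mem.word i 0 = d 0 := by rw [m]; simp
  obtain hl | ⟨hl, hl'⟩ := rightPartner_cases (N := N) (b := b) (B := s₄.mem.word) i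
  · have hb2 := hl.2.1
    refine ⟨fun hc => by omega, fun _ => ?_⟩
    have he : rightPartner N b s₄.mem.word i = (d 0).toNat := by
      rw [← hl.2.2.2.1, hd0]
    rw [he] at hl r₅ hb2
    have hN' := hl.2.2.1
    refine wp_putWord h.1 h.2 (by omega) (by omega) r₅ (h.address_lt hN' 0)
      fun s₆ b₆ m₆ f₆ => ?_
    apply H
    · rw [b₆, m₅, bt]
    · rw [m] at hl
      rw [m₆, m₅, m, eq_iff_toNat.2 r₅, setPlain, if_pos hl,
        Function.update_of_ne (show (d 0).toNat ≠ i by omega)]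
    · intro r hr
      rw [f₆ r (by omega), f₅ r hr (by omega), f r (by omega)]
  · refine ⟨fun _ => ?_, fun hc => absurd hl hc⟩
    refine wp_skip fun s₆ m₆ f₆ => ?_
    apply H
    · rw [m₆, m₅, bt]
    · rw [m] at hl'
      rw [m₆, m₅, m, setPlain, if_neg (hl' _)]
    · intro r hr
      rw [f₆ r (by omega), f₅ r hr (by omega), f r (by omega)]

theorem wp_linkBlocks (h : Context N b Δ s) {F J i j : ℕ} (hF : F < 20) (hJ : J < 20)
    (hi : (s.regs F).toNat = i) (hj : (s.regs J).toNat = j) (hib : i < b) (hbj : b ≤ j)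
    (hjN : j < N)
    (H : ∀ s' : State n w, s'.mem.bit = s.mem.bit →
      s'.mem.word = setLink s.mem.word i j s.data →
      (∀ r < 20, s'.regs r = s.regs r) → Q s') :
    wp (linkBlocks F J) Q s := by
  have hbN := h.le
  have hlt := h.address_lt (k := i) (by omega)
  have hlt' := h.address_lt hjN
  rw [linkBlocks, wp_seq]
  refine wp_putWord h.1 h.2 (by omega) (by omega) hi (hlt 0) fun s₁ b₁ m₁ f₁ => ?_
  rw [wp_seq]
  refine wp_putWord h.1 h.2 (by omega) (by omega) (by rw [f₁ F (by omega), hi]) (hlt 1)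
    fun s₂ b₂ m₂ f₂ => ?_
  rw [wp_seq]
  refine wp_putWord h.1 h.2 (by omega) (by omega)
    (by rw [f₂ F (by omega), f₁ F (by omega), hi]) (hlt 2) fun s₃ b₃ m₃ f₃ => ?_
  rw [wp_seq]
  refine wp_putWord h.1 h.2 (by omega) (by omega)
    (by rw [f₃ F (by omega), f₂ F (by omega), f₁ F (by omega), hi]) (hlt 3)
    fun s₄ b₄ m₄ f₄ => ?_
  have f : ∀ r < 30, s₄.regs r = s.regs r := fun r hr => by
    rw [f₄ r hr, f₃ r hr, f₂ r hr, f₁ r hr]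
  have m : s₄.mem.word = Function.update s.mem.word i
      ![s.regs J, s.regs 10, s.regs 11, s.regs 12] := by
    rw [m₄, m₃, m₂, m₁, f₃ 12 (by omega), f₂ 12 (by omega), f₁ 12 (by omega),
      f₂ 11 (by omega), f₁ 11 (by omega), f₁ 10 (by omega)]
    simp only [Function.update_idem, Function.update_self]
    congr 1
    ext1 c
    fin_cases c <;> simp
  rw [wp_seq]
  refine wp_putWord h.1 h.2 (by omega) (by omega) (by rw [f J (by omega), hj]) (hlt' 0)
    fun s₅ b₅ m₅ f₅ => ?_
  refine wp_putWord h.1 h.2 (by omega) (by omega)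
    (by rw [f₅ J (by omega), f J (by omega), hj]) (hlt' 3) fun s₆ b₆ m₆ f₆ => ?_
  have eJ : BitVec.ofNat w j = s.regs J := by rw [← hj]; simp
  have eF : BitVec.ofNat w i = s.regs F := by rw [← hi]; simp
  have hne : j ≠ i := by omega
  apply H
  · rw [b₆, b₅, b₄, b₃, b₂, b₁]
  · rw [m₆, m₅, m, f₅ 13 (by omega), f 13 (by omega), f F (by omega), setLink, eJ, eF]
    simp only [Function.update_idem, Function.update_self, Function.update_of_ne hne]
    congr 1
    ext1 c
    fin_cases c <;> simp [State.data]
  · intro r hr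
    rw [f₆ r (by omega), f₅ r (by omega), f r (by omega)]

theorem wp_loadPlain (h : Context N b Δ s) {I i : ℕ} (hI : I < 10) (hi : (s.regs I).toNat = i)
    (hiN : i < N)
    (H : ∀ s' : State n w, s'.mem = s.mem → s'.data = s.mem.word i →
      (∀ r < 20, r < 10 ∨ 14 ≤ r → s'.regs r = s.regs r) → Q s') :
    wp (loadPlain I) Q s := by
  have hlt := h.address_lt hiN
  rw [loadPlain, wp_seq]
  refine wp_getWord h.1 h.2 (by omega) hi (hlt 0) fun s₂ m₂ r₂ f₂ => ?_
  rw [wp_seq]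
  refine wp_getWord h.1 h.2 (by omega) (by rw [f₂ I (by omega) (by omega), hi]) (hlt 1)
    fun s₃ m₃ r₃ f₃ => ?_
  rw [wp_seq]
  refine wp_getWord h.1 h.2 (by omega)
    (by rw [f₃ I (by omega) (by omega), f₂ I (by omega) (by omega), hi]) (hlt 2)
    fun s₄ m₄ r₄ f₄ => ?_
  refine wp_getWord h.1 h.2 (by omega)
    (by rw [f₄ I (by omega) (by omega), f₃ I (by omega) (by omega),
      f₂ I (by omega) (by omega), hi]) (hlt 3)
    fun s₅ m₅ r₅ f₅ => ?_
  apply H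
  · rw [m₅, m₄, m₃, m₂]
  · rw [State.data, r₅, f₅ 12 (by omega) (by omega), r₄,
      f₅ 11 (by omega) (by omega), f₄ 11 (by omega) (by omega), r₃,
      f₅ 10 (by omega) (by omega), f₄ 10 (by omega) (by omega), f₃ 10 (by omega) (by omega), r₂,
      m₄, m₃, m₂]
    ext1 c
    fin_cases c <;> rfl
  · intro r hr h2
    rw [f₅ r (by omega) (by omega), f₄ r (by omega) (by omega), f₃ r (by omega) (by omega),
      f₂ r (by omega) (by omega)]

theorem wp_changeWord (hw : 3 ≤ w) {c : Fin 4} (hc : (s.regs 8).toNat = c)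
    (H : ∀ s' : State n w, s'.mem = s.mem → s'.data = Function.update s.data c (s.regs 2) →
      (∀ r < 20, r < 10 ∨ 14 ≤ r → s'.regs r = s.regs r) → Q s') :
    wp changeWord Q s := by
  have h8 : 2 ^ 3 ≤ 2 ^ w := Nat.pow_le_pow_right (by norm_num) hw
  have e1 : (1 : ℕ) % 2 ^ w = 1 := Nat.mod_eq_of_lt (by omega)
  have e2 : (2 : ℕ) % 2 ^ w = 2 := Nat.mod_eq_of_lt (by omega)
  simp only [changeWord, wp_seq, wp_branch, wp_const, wp_copy, Test.holds, eq_iff_toNat]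
  norm_num [e1, e2]
  simp only [hc]
  refine ⟨fun h => ?_, fun h0 => ⟨fun h => ?_, fun h1 => ⟨fun h => ?_, fun h2 => ?_⟩⟩⟩
  · obtain rfl : c = 0 := Fin.ext h
    refine H _ rfl ?_ fun r hr h' => ?_
    · ext1 c; fin_cases c <;> simp [State.data]
    · simp [show r ≠ 10 by omega, show r ≠ 20 by omega]
  · obtain rfl : c = 1 := Fin.ext h
    refine H _ rfl ?_ fun r hr h' => ?_
    · ext1 c; fin_cases c <;> simp [State.data]
    · simp [show r ≠ 11 by omega, show r ≠ 20 by omega]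
  · obtain rfl : c = 2 := Fin.ext h
    refine H _ rfl ?_ fun r hr h' => ?_
    · ext1 c; fin_cases c <;> simp [State.data]
    · simp [show r ≠ 12 by omega, show r ≠ 20 by omega]
  · obtain rfl : c = 3 := Fin.ext (by have := c.isLt; simp; omega)
    refine H _ rfl ?_ fun r hr h' => ?_
    · ext1 c; fin_cases c <;> simp [State.data]
    · simp [show r ≠ 13 by omega, show r ≠ 20 by omega]

/-- The continuation needs more than `Rep`. Only words 0 of right blocks may change, so the stored
boundary and fill value survive; no link appears; and register `P` names the former partner of `j`,
or `j` itself if it represented `Δ` without a partner. -/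
theorem wp_detach (h : Context N b Δ s) {V : ℕ → Fin 4 → BitVec w}
    (hR : Rep N b Δ s.mem.word V) {J P j : ℕ} (hJ : J < 10 ∨ 14 ≤ J ∧ J < 20)
    (hP : 14 ≤ P ∧ P < 20)
    (hJP : J ≠ P) (hj : (s.regs J).toNat = j) (hbj : b ≤ j) (hjN : j < N)
    (H : ∀ s' : State n w, s'.mem.bit = s.mem.bit → s'.data = V j →
      Rep N b Δ s'.mem.word (Function.update V j fun _ => Δ) →
      (∀ k, b ≤ k → ∀ c ≠ 0, s'.mem.word k c = s.mem.word k c) →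
      (∀ i j', Link N b s'.mem.word i j' → Link N b s.mem.word i j' ∧ j' ≠ j) →
      (Link N b s.mem.word (s'.regs P).toNat j ∨
        ((s'.regs P).toNat = j ∧ V j = fun _ => Δ)) →
      (∀ r < 20, r ≠ P → r < 10 ∨ 14 ≤ r → s'.regs r = s.regs r) → Q s') :
    wp (detach J P) Q s := by
  have hbN := h.le
  rw [detach, wp_seq]
  refine wp_loadRight h hR hJ hP hJP hj hbj hjN fun s₁ m₁ r₁ d₁ f₁ => ?_
  have eJ : (s₁.regs J).toNat = j := by rw [f₁ J (by omega) (by omega) (by omega), hj]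
  have e5 : s₁.regs 5 = Δ := by rw [f₁ 5 (by omega) (by omega) (by omega), h.reg5]
  have h' : Context N b Δ s₁ := h.of_regs (f₁ 3 (by omega) (by omega) (by omega))
    (f₁ 4 (by omega) (by omega) (by omega)) (f₁ 5 (by omega) (by omega) (by omega))
  rw [wp_branch]
  simp only [Test.holds, eq_iff_toNat, r₁, eJ]
  obtain hl | ⟨hl, hl'⟩ := leftPartner_cases (N := N) (b := b) (B := s.mem.word) j
  · have hp := hl.1
    refine ⟨fun hc => by omega, fun _ => ?_⟩
    refine wp_plainBlock h' (by omega) (by omega) (by omega) (by omega) (by omega) r₁ hp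
      fun s₂ b₂ m₂ f₂ => ?_
    have ed : ![Δ, Δ, Δ, Δ] = fun _ => Δ := by ext1 c; fin_cases c <;> rfl
    rw [e5, m₁, ed] at m₂
    have eP : (s₂.regs P).toNat = leftPartner N b s.mem.word j := by rw [f₂ P (by omega), r₁]
    apply H
    · rw [b₂, m₁]
    · simp only [State.data, f₂ 10 (by omega), f₂ 11 (by omega), f₂ 12 (by omega),
        f₂ 13 (by omega)]
      exact d₁
    · rw [m₂]; exact hR.setPlain_linked hl
    · intro k hk c hc
      rw [m₂, setPlain_of_ne (by omega) _ hc]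
    · intro i j' hi
      rw [m₂, link_setPlain hp] at hi
      refine ⟨hi.2, ?_⟩
      rintro rfl
      exact hi.1 (hi.2.left_unique hl)
    · rw [eP]
      exact Or.inl hl
    · intro r hr h1 h2
      rw [f₂ r hr, f₁ r hr h1 h2]
  · refine ⟨fun _ => ?_, fun hc => absurd hl hc⟩
    refine wp_skip fun s₂ m₂ f₂ => ?_
    have hV := hR.right_free j hbj hjN hl'
    apply H
    · rw [m₂, m₁]
    · simp only [State.data, f₂ 10 (by omega), f₂ 11 (by omega), f₂ 12 (by omega),
        f₂ 13 (by omega)]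
      exact d₁
    · rw [m₂, m₁, ← hV, Function.update_eq_self]; exact hR
    · intro k _ c _
      rw [m₂, m₁]
    · intro i j' hi
      rw [m₂, m₁] at hi
      exact ⟨hi, by rintro rfl; exact hl' _ hi⟩
    · right
      rw [f₂ P (by omega), r₁]
      exact ⟨hl, hV⟩
    · intro r hr h1 h2
      rw [f₂ r (by omega), f₁ r hr h1 h2]

end

/-! ### The operations -/

/-- Move the boundary past one block, which becomes plain.  Register `15` is set to a free block on
the left that holds only copies of the last value that was filled in. -/
def extend : Program :=
  .instr (.copy 14 4) ;; detach 14 15 ;; .instr (.const 20 1) ;; .instr (.binop .add 4 4 20) ;;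
    plainBlock 14 10 11 12 13

/-- Unlink the left block `7`, replacing it by the left block `15`. -/
def relocate : Program :=
  findRight 7 14 ;; .branch (.eq 14 7) skip (detach 14 16 ;; linkBlocks 15 14)

/-- Write into the structured part of the memory. -/
def writeBlock : Program :=
  getWord 4 6 1 ;; getWord 5 6 2 ;; extend ;;
    .branch (.eq 4 3)
      (.instr (.const 20 1) ;; .instr (.putBit 20) ;; .instr (.store 1 2))
      (putWord 6 1 4 ;;
        .branch (.lt 7 4)
          (relocate ;; loadPlain 7 ;; changeWord ;; plainBlock 7 10 11 12 13)
          (detach 7 16 ;; changeWord ;; linkBlocks 15 7))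

/-- Return the data word whose number is in register `8`. -/
def returnWord : Program :=
  .instr (.const 20 0) ;; .branch (.eq 8 20) (.instr (.copy 0 10))
    (.instr (.const 20 1) ;; .branch (.eq 8 20) (.instr (.copy 0 11))
      (.instr (.const 20 2) ;; .branch (.eq 8 20) (.instr (.copy 0 12)) (.instr (.copy 0 13))))

/-- Read from the structured part of the memory. -/
def readBlock : Program :=
  getWord 4 6 1 ;; getWord 5 6 2 ;;
    .branch (.lt 7 4)
      (findRight 7 14 ;; .branch (.eq 14 7) (.instr (.load 0 1)) (.instr (.copy 0 5)))
      (loadRight 7 14 ;; returnWord)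

/-- Compute the number of blocks, the number of the last block, and the position of the index. -/
def prologue : Program :=
  .instr (.const 20 4) ;; .instr (.binop .div 3 0 20) ;; .instr (.binop .div 7 1 20) ;;
    .instr (.binop .mod 8 1 20) ;; .instr (.const 21 1) ;; .instr (.binop .sub 6 3 21) ;;
    .instr (.getBit 22) ;; .instr (.const 23 0)

/-- Store the value of a fill at offset `c` beyond the last block, if there is such a cell. -/
def fillTail (c : ℕ) : Program :=
  .instr (.const 26 c) ;;
    .branch (.lt 24 26) skip (.instr (.binop .add 27 25 26) ;; .instr (.store 27 2))

/-- An array access: `p` if it concerns the structured part of the memory, and otherwise the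
instruction `i`. -/
def dispatch (p : Program) (i : Instr) : Program :=
  prologue ;; .branch (.eq 22 23) (.branch (.lt 7 3) p (.instr i)) (.instr i)

def fillProgram : Program :=
  prologue ;; .instr (.binop .mod 24 0 20) ;; .instr (.binop .mul 25 20 3) ;;
    fillTail 0 ;; fillTail 1 ;; fillTail 2 ;; fillTail 3 ;;
    .branch (.lt 23 3) (putWord 6 1 23 ;; putWord 6 2 2 ;; .instr (.putBit 23)) skip

/-- The fillable array with one bit of redundancy. -/
def implementation : Implementation where
  init := fillProgram
  read := dispatch readBlock (.load 0 1)
  write := dispatch writeBlock (.store 1 2)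
  fill := fillProgram

/-- The array represented by blocks. -/
def entry {w : ℕ} (V : ℕ → Fin 4 → BitVec w) (i : ℕ) : BitVec w := V (i / 4) (Fin.ofNat 4 i)

/-- The memory `m` represents the array `A`. -/
def Represents {n w : ℕ} (m : Memory n w) (A : Fin n → BitVec w) : Prop :=
  ∃ V : ℕ → Fin 4 → BitVec w, (∀ i : Fin n, A i = entry V i) ∧
    (m.bit = true → V = m.word) ∧
    (m.bit = false → ∃ b Δ, b ≤ (n - 1) / 4 ∧ Rep ((n - 1) / 4) b Δ m.word V ∧
      -- The strict inequality keeps the last block on the right, where words 1 and 2 are unused.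
      -- Without blocks nothing has to be stored, since every cell is beyond the blocks.
      (0 < (n - 1) / 4 → b < (n - 1) / 4 ∧ (m.word ((n - 1) / 4 - 1) 1).toNat = b ∧
        m.word ((n - 1) / 4 - 1) 2 = Δ))

/-! ### Reading and writing in the structured part. -/

section

variable {n w N b : ℕ} {Δ : BitVec w} {Q : State n w → Prop} {s : State n w}

theorem entry_update {V : ℕ → Fin 4 → BitVec w} {A : Fin n → BitVec w}
    (h : ∀ i : Fin n, A i = entry V i) (i : Fin n) (v : BitVec w) (k : Fin n) :
    Function.update A i v k = entry (Function.update V (i / 4)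
      (Function.update (V (i / 4)) (Fin.ofNat 4 i) v)) k := by
  unfold entry
  by_cases hk : (k : ℕ) / 4 = i / 4
  · rw [hk, Function.update_self]
    by_cases hc : Fin.ofNat 4 k = Fin.ofNat 4 i
    · rw [hc, Function.update_self]
      have : k = i := by
        have hc' := congrArg Fin.val hc
        simp only [Fin.ofNat] at hc'
        exact Fin.ext (by omega)
      rw [this, Function.update_self]
    · have : k ≠ i := by rintro rfl; exact hc rfl
      rw [Function.update_of_ne this, Function.update_of_ne hc, h, entry, hk]
  · have : k ≠ i := by rintro rfl; exact hk rfl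
    rw [Function.update_of_ne this, Function.update_of_ne hk, h, entry]

theorem setLink_of_ne {B : ℕ → Fin 4 → BitVec w} {i j k : ℕ} (hk : k ≠ i)
    (d : Fin 4 → BitVec w) {c : Fin 4} (hc : c = 1 ∨ c = 2) : setLink B i j d k c = B k c := by
  unfold setLink
  by_cases h : k = j
  · subst h
    rw [Function.update_self]
    obtain rfl | rfl := hc <;> rfl
  · rw [Function.update_of_ne h, Function.update_of_ne hk]

/-- Register `15` names the former partner of `b`, whose space is no longer needed, or else `b`
itself, which then represents `Δ`. The stored fill value is lost only if the last block itself
crosses the boundary. -/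
theorem wp_extend (h : Context N b Δ s) (hb : b < N) {V : ℕ → Fin 4 → BitVec w}
    (hR : Rep N b Δ s.mem.word V)
    (H : ∀ s' : State n w, s'.mem.bit = s.mem.bit → Context N (b + 1) Δ s' →
      Rep N (b + 1) Δ s'.mem.word V →
      (b + 1 < N → s'.mem.word (N - 1) 2 = s.mem.word (N - 1) 2) →
      (s'.regs 15).toNat < b + 1 →
      (∀ j, ¬ Link N (b + 1) s'.mem.word (s'.regs 15).toNat j) →
      (V (s'.regs 15).toNat = fun _ => Δ) →
      (∀ r < 10, r ≠ 4 → s'.regs r = s.regs r) → Q s') :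
    wp extend Q s := by
  rw [extend, wp_seq, wp_copy, wp_seq]
  have h₁ : Context N b Δ (s.setReg 14 (s.regs 4)) := h.of_regs (by simp) (by simp) (by simp)
  refine wp_detach h₁ (V := V) hR (j := b) (by omega) (by omega) (by omega) (by simp [h.reg4])
    le_rfl hb fun s₂ b₂ d₂ R₂ w₂ v₂ p₂ f₂ => ?_
  rw [setReg_mem] at w₂ v₂ p₂ b₂
  have u₂ : ∀ i, ¬ Link N b s₂.mem.word i b := fun i hi => (v₂ i b hi).2 rfl
  have f₂' : ∀ r < 10, s₂.regs r = s.regs r := fun r hr => by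
    rw [f₂ r (by omega) (by omega) (by omega)]
    simp [show r ≠ 14 by omega]
  rw [wp_seq, wp_const, wp_seq, wp_binop]
  generalize hs₃ : State.setReg (State.setReg s₂ 20 (BitVec.ofNat w 1)) 4 _ = s₃
  have m₃ : s₃.mem = s₂.mem := by rw [← hs₃]; rfl
  have f₃ : ∀ r < 20, r ≠ 4 → s₃.regs r = s₂.regs r := fun r hr h4 => by
    rw [← hs₃]; simp [h4, show r ≠ 20 by omega]
  have hlt := h.lt
  have hn := h.le_pow
  have h8 : 2 ^ 3 ≤ 2 ^ w := Nat.pow_le_pow_right (by norm_num) h.three_le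
  have e4 : (s₃.regs 4).toNat = b + 1 := by
    have e1 : (1 : ℕ) % 2 ^ w = 1 := Nat.mod_eq_of_lt (by omega)
    have e2 : (b + 1) % 2 ^ w = b + 1 := Nat.mod_eq_of_lt (by omega)
    rw [← hs₃]
    simp [BinOp.eval, BitVec.toNat_add, f₂' 4 (by omega), h.reg4, e2]
  have h₃ : Context N (b + 1) Δ s₃ :=
    ⟨h.1, h.2, h.3, hb, by rw [f₃ 3 (by omega) (by omega), f₂' 3 (by omega), h.reg3], e4,
      by rw [f₃ 5 (by omega) (by omega), f₂' 5 (by omega), h.reg5]⟩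
  refine wp_plainBlock h₃ (i := b) (by omega) (by omega) (by omega) (by omega) (by omega)
    (by rw [f₃ 14 (by omega) (by omega), f₂ 14 (by omega) (by omega) (by omega)]; simp [h.reg4])
    (by omega) fun s₄ b₄ m₄ f₄ => ?_
  have ed : ![s₃.regs 10, s₃.regs 11, s₃.regs 12, s₃.regs 13] = V b := by
    rw [← d₂, State.data, f₃ 10 (by omega) (by omega), f₃ 11 (by omega) (by omega),
      f₃ 12 (by omega) (by omega), f₃ 13 (by omega) (by omega)]
  rw [ed, m₃] at m₄
  have e15 : s₄.regs 15 = s₂.regs 15 := by rw [f₄ 15 (by omega), f₃ 15 (by omega) (by omega)]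
  apply H
  · rw [b₄, m₃, b₂]
  · exact h₃.of_regs (f₄ 3 (by omega)) (f₄ 4 (by omega)) (f₄ 5 (by omega))
  · rw [m₄]
    -- After `detach` block `b` represents `Δ`; writing its data back as a plain block restores `V`.
    have := R₂.extend hb u₂ (V b)
    rwa [Function.update_idem, Function.update_eq_self] at this
  · intro hb'
    rw [m₄, setPlain_of_ne (by omega) _ (by decide), w₂ _ (by omega) _ (by decide)]
  · rw [e15]
    obtain h1 | ⟨h1, -⟩ := p₂
    · have := h1.1; omega
    · omega
  -- A link of the former partner would be an old one, hence a link with `b`, which has been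
  -- detached; and `setPlain` leaves `b` without links.
  · intro j hj
    rw [e15, m₄, link_setPlain (Nat.lt_succ_self b)] at hj
    rw [link_succ u₂ hj.1] at hj
    obtain h1 | ⟨h1, -⟩ := p₂
    · obtain ⟨h2, h3⟩ := v₂ _ _ hj.2
      exact h3 (h2.right_unique h1)
    · exact hj.1 h1
  · rw [e15]
    obtain h1 | ⟨h1, h2⟩ := p₂
    · exact hR.left_linked _ _ h1
    · rw [h1, h2]
  · intro r hr h4
    rw [f₄ r (by omega), f₃ r (by omega) h4, f₂' r hr]

/-- A linked block `q` carries the data of a right block, which must not be overwritten. Moving them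
to `f` keeps `V`, because `q` and `f` both represent `Δ`. If `q` is free, there is nothing to do;
this covers `q = f`. -/
theorem wp_relocate (h : Context N b Δ s) {V : ℕ → Fin 4 → BitVec w}
    (hR : Rep N b Δ s.mem.word V) {q f : ℕ} (hq : (s.regs 7).toNat = q)
    (hf : (s.regs 15).toNat = f) (hqb : q < b) (hfb : f < b) (hbN : b < N)
    (hfl : ∀ j, ¬ Link N b s.mem.word f j) (hfV : V f = fun _ => Δ)
    (H : ∀ s' : State n w, s'.mem.bit = s.mem.bit → Rep N b Δ s'.mem.word V →
      (∀ j, ¬ Link N b s'.mem.word q j) →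
      (∀ c, c = 1 ∨ c = 2 → s'.mem.word (N - 1) c = s.mem.word (N - 1) c) →
      (∀ r < 10, s'.regs r = s.regs r) → Q s') :
    wp relocate Q s := by
  have hlt := h.lt
  have hn := h.le_pow
  rw [relocate, wp_seq]
  refine wp_findRight h (by omega) (by omega) (by omega) (by omega) hq hqb
    fun s₁ m₁ r₁ f₁ => ?_
  rw [wp_branch]
  simp only [Test.holds, eq_iff_toNat, r₁, f₁ 7 (by omega) (by omega), hq]
  obtain hl | ⟨hl, hl'⟩ := rightPartner_cases (N := N) (b := b) (B := s.mem.word) q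
  · generalize rightPartner N b s.mem.word q = j at hl r₁
    have hb1 := hl.2.1
    have hb2 := hl.2.2.1
    refine ⟨fun _ => by omega, fun _ => ?_⟩
    have h₁ : Context N b Δ s₁ := h.of_regs (f₁ 3 (by omega) (by omega))
      (f₁ 4 (by omega) (by omega)) (f₁ 5 (by omega) (by omega))
    rw [← m₁] at hR hl hfl
    rw [wp_seq]
    refine wp_detach h₁ hR (by omega) (by omega) (by omega) r₁ hb1 hb2
      fun s₂ b₂ d₂ R₂ w₂ v₂ p₂ f₂ => ?_
    have h₂ : Context N b Δ s₂ := h₁.of_regs (f₂ 3 (by omega) (by omega) (by omega))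
      (f₂ 4 (by omega) (by omega) (by omega)) (f₂ 5 (by omega) (by omega) (by omega))
    have u₂ : ∀ i, ¬ Link N b s₂.mem.word i j := fun i hi => (v₂ i j hi).2 rfl
    have hfl₂ : ∀ j, ¬ Link N b s₂.mem.word f j := fun j' hj' => hfl j' (v₂ f j' hj').1
    refine wp_linkBlocks h₂ (i := f) (j := j) (by omega) (by omega)
      (by rw [f₂ 15 (by omega) (by omega) (by omega), f₁ 15 (by omega) (by omega), hf])
      (by rw [f₂ 14 (by omega) (by omega) (by omega), r₁]) hfb hb1 hb2
      fun s₃ b₃ m₃ f₃ => ?_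
    have hNw : N ≤ 2 ^ w := by omega
    apply H
    · rw [b₃, b₂, m₁]
    · rw [m₃, d₂]
      have := R₂.setLink hfb hb1 hb2 hNw hfl₂ u₂
        (by rw [Function.update_of_ne (by omega), hfV]) (V j)
      rwa [Function.update_idem, Function.update_eq_self] at this
    · intro j' hj'
      rw [m₃, link_setLink hfb hb1 hb2 hNw hfl₂ u₂] at hj'
      obtain ⟨rfl, -⟩ | hj' := hj'
      · exact hfl _ hl
      · obtain ⟨h2, h3⟩ := v₂ _ _ hj'
        exact h3 (h2.right_unique hl)
    · intro c hc
      rw [m₃, setLink_of_ne (by omega) _ hc, w₂ _ (by omega) _ (by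
        obtain rfl | rfl := hc <;> decide), m₁]
    · intro r hr
      rw [f₃ r (by omega), f₂ r (by omega) (by omega) (by omega), f₁ r (by omega) (by omega)]
  · refine ⟨fun _ => ?_, fun hc => absurd hl hc⟩
    refine wp_skip fun s₂ m₂ f₂ => ?_
    apply H
    · rw [m₂, m₁]
    · rwa [m₂, m₁]
    · rwa [m₂, m₁]
    · intro c _
      rw [m₂, m₁]
    · intro r hr
      rw [f₂ r (by omega), f₁ r (by omega) (by omega)]

/-- A block exists only if `n ≥ 5`, whence `2 ^ w > 4`. -/
theorem three_le_of_lt (hn : n ≤ 2 ^ w) (hN : 0 < (n - 1) / 4) : 3 ≤ w := by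
  by_contra! h
  have : 2 ^ w ≤ 2 ^ 2 := Nat.pow_le_pow_right (by norm_num) (by omega)
  omega

/-- For `w ≤ 2` the literal `4` becomes `0`. As division by `0` gives quotient `0` and remainder
`x`, the results are still right: every word is then less than `4`. -/
theorem four_mod_two_pow (hw : 1 ≤ w) : 3 ≤ w ∧ 4 % 2 ^ w = 4 ∨ 2 ^ w ≤ 4 ∧ 4 % 2 ^ w = 0 := by
  by_cases h : 3 ≤ w
  · have h8 : 2 ^ 3 ≤ 2 ^ w := Nat.pow_le_pow_right (by norm_num) h
    exact Or.inl ⟨h, Nat.mod_eq_of_lt (by omega)⟩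
  · right
    obtain rfl | rfl : w = 1 ∨ w = 2 := by omega
    · norm_num
    · norm_num

theorem div_four_mod_two_pow (hw : 1 ≤ w) {x : ℕ} (hx : x < 2 ^ w) : x / (4 % 2 ^ w) = x / 4 := by
  obtain ⟨-, h⟩ | ⟨h', h⟩ := four_mod_two_pow hw <;> rw [h]
  rw [Nat.div_zero, Nat.div_eq_of_lt (by omega)]

theorem mod_four_mod_two_pow (hw : 1 ≤ w) {x : ℕ} (hx : x < 2 ^ w) : x % (4 % 2 ^ w) = x % 4 := by
  obtain ⟨-, h⟩ | ⟨h', h⟩ := four_mod_two_pow hw <;> rw [h]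
  rw [Nat.mod_zero, Nat.mod_eq_of_lt (by omega)]

/-- The number of blocks is computed from `n - 1`, because `n` does not fit into a word if `n = 2 ^
w`. Register `6` wraps around if there is no block, hence the condition on it. -/
theorem wp_prologue (hn : 1 ≤ n) (hw : 1 ≤ w) (hnw : n ≤ 2 ^ w) (m : Memory n w)
    (i v : BitVec w)
    (H : ∀ s' : State n w, s'.mem = m → (s'.regs 0).toNat = n - 1 → s'.regs 1 = i →
      s'.regs 2 = v → (s'.regs 3).toNat = (n - 1) / 4 → (s'.regs 7).toNat = i.toNat / 4 →
      (s'.regs 8).toNat = i.toNat % 4 → (0 < (n - 1) / 4 → (s'.regs 6).toNat = (n - 1) / 4 - 1) →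
      s'.regs 20 = BitVec.ofNat w 4 → (s'.regs 22 = s'.regs 23 ↔ m.bit = false) →
      s'.regs 23 = 0 → Q s') :
    wp prologue Q (startState m i v) := by
  have h1 : (n - 1) % 2 ^ w = n - 1 := Nat.mod_eq_of_lt (by omega)
  have h2 : 1 % 2 ^ w = 1 := Nat.mod_eq_of_lt (Nat.one_lt_two_pow (by omega))
  simp only [prologue, wp_seq, wp_const, wp_binop, wp_getBit]
  apply H
  · rfl
  · simp [startState, Nat.mod_eq_of_lt (show n - 1 < 2 ^ w by omega)]
  · simp [startState]
  · simp [startState]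
  · simp only [setReg_regs, startState]
    norm_num [BinOp.eval]
    rw [h1, div_four_mod_two_pow hw (by omega)]
  · simp only [setReg_regs, startState]
    norm_num [BinOp.eval]
    rw [div_four_mod_two_pow hw i.isLt]
  · simp only [setReg_regs, startState]
    norm_num [BinOp.eval]
    rw [mod_four_mod_two_pow hw i.isLt]
  · intro h
    simp only [setReg_regs, startState]
    norm_num [BinOp.eval]
    rw [h1, h2, div_four_mod_two_pow hw (by omega),
      show 2 ^ w - 1 + (n - 1) / 4 = (n - 1) / 4 - 1 + 2 ^ w by omega, Nat.add_mod_right,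
      Nat.mod_eq_of_lt (by omega)]
  · simp
  · simp only [setReg_regs, startState]
    cases hb : m.bit <;> simp [hb, eq_iff_toNat, h2]
  · simp

theorem wp_returnWord (hw : 3 ≤ w) {c : Fin 4} (hc : (s.regs 8).toNat = c)
    (H : ∀ s' : State n w, s'.mem = s.mem → s'.regs 0 = s.data c → Q s') :
    wp returnWord Q s := by
  have h8 : 2 ^ 3 ≤ 2 ^ w := Nat.pow_le_pow_right (by norm_num) hw
  have e1 : (1 : ℕ) % 2 ^ w = 1 := Nat.mod_eq_of_lt (by omega)
  have e2 : (2 : ℕ) % 2 ^ w = 2 := Nat.mod_eq_of_lt (by omega)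
  simp only [returnWord, wp_seq, wp_branch, wp_const, wp_copy, Test.holds, eq_iff_toNat]
  norm_num [e1, e2]
  simp only [hc]
  refine ⟨fun h => ?_, fun h0 => ⟨fun h => ?_, fun h1 => ⟨fun h => ?_, fun h2 => ?_⟩⟩⟩
  · obtain rfl : c = 0 := Fin.ext h
    exact H _ rfl (by simp [State.data])
  · obtain rfl : c = 1 := Fin.ext (by simpa [e1] using h)
    exact H _ rfl (by simp [State.data])
  · obtain rfl : c = 2 := Fin.ext (by simpa [e2] using h)
    exact H _ rfl (by simp [State.data])
  · obtain rfl : c = 3 := Fin.ext (by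
      have := c.isLt
      simp
      omega)
    exact H _ rfl (by simp [State.data])

theorem wp_readBlock (hnw : n ≤ 2 ^ w) {V : ℕ → Fin 4 → BitVec w} {i : ℕ} (hi : i < n)
    (h1 : (s.regs 1).toNat = i) (h3 : (s.regs 3).toNat = N)
    (h7 : (s.regs 7).toNat = i / 4) (h8 : (s.regs 8).toNat = i % 4)
    (h6 : (s.regs 6).toNat = N - 1) (hN : 4 * N < n) (hiN : i / 4 < N)
    (hb : b < N) (hR : Rep N b Δ s.mem.word V) (hwb : (s.mem.word (N - 1) 1).toNat = b)
    (hwΔ : s.mem.word (N - 1) 2 = Δ)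
    (H : ∀ s' : State n w, s'.mem = s.mem → s'.regs 0 = entry V i → Q s') :
    wp readBlock Q s := by
  have hw : 3 ≤ w := three_le_of_lt hnw (by omega)
  have hci : 4 * (i / 4) + (Fin.ofNat 4 i : ℕ) = i := by simp only [Fin.ofNat]; omega
  rw [readBlock, wp_seq]
  refine wp_getWord hw hnw (by omega) h6 (by simp; omega) fun s₁ m₁ r₁ f₁ => ?_
  rw [wp_seq]
  refine wp_getWord hw hnw (by omega) (by rw [f₁ 6 (by omega) (by omega), h6]) (by simp; omega)
    fun s₂ m₂ r₂ f₂ => ?_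
  have f : ∀ r < 30, r ≠ 4 → r ≠ 5 → s₂.regs r = s.regs r := fun r hr h4 h5 => by
    rw [f₂ r hr h5, f₁ r hr h4]
  have m : s₂.mem = s.mem := by rw [m₂, m₁]
  have h : Context N b Δ s₂ := ⟨hw, hnw, hN, hb.le,
    by rw [f 3 (by omega) (by omega) (by omega), h3],
    by rw [f₂ 4 (by omega) (by omega), r₁, hwb], by rw [r₂, m₁, hwΔ]⟩
  rw [← m] at hR
  have e7 : (s₂.regs 7).toNat = i / 4 := by rw [f 7 (by omega) (by omega) (by omega), h7]
  rw [wp_branch]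
  simp only [Test.holds, e7, h.reg4]
  refine ⟨fun hlt => ?_, fun hlt => ?_⟩
  · rw [wp_seq]
    refine wp_findRight h (by omega) (by omega) (by omega) (by omega) e7 hlt
      fun s₃ m₃ r₃ f₃ => ?_
    rw [wp_branch]
    simp only [Test.holds, eq_iff_toNat, r₃, f₃ 7 (by omega) (by omega), e7]
    obtain hl | ⟨hl, hl'⟩ := rightPartner_cases (N := N) (b := b) (B := s₂.mem.word) (i / 4)
    · have hb1 := hl.2.1
      refine ⟨fun _ => by omega, fun _ => ?_⟩
      rw [wp_copy]
      refine H _ (by rw [setReg_mem, m₃, m]) ?_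
      rw [entry, hR.left_linked _ _ hl, setReg_regs, if_pos rfl, f₃ 5 (by omega) (by omega),
        h.reg5]
    · refine ⟨fun _ => ?_, fun hc => absurd hl hc⟩
      have e1 : (s₃.regs 1).toNat = 4 * (i / 4) + (Fin.ofNat 4 i : ℕ) := by
        rw [f₃ 1 (by omega) (by omega), f 1 (by omega) (by omega) (by omega), h1, hci]
      rw [wp_load e1 (by omega)]
      refine H _ (by rw [setReg_mem, m₃, m]) ?_
      rw [entry, hR.left_free _ hlt hl', setReg_regs, if_pos rfl, m₃]
  · rw [wp_seq]
    refine wp_loadRight h hR (by omega) (by omega) (by omega) e7 (by omega) hiN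
      fun s₃ m₃ r₃ d₃ f₃ => ?_
    refine wp_returnWord hw (c := Fin.ofNat 4 i) ?_ fun s₄ m₄ r₄ => ?_
    · rw [f₃ 8 (by omega) (by omega) (by omega), f 8 (by omega) (by omega) (by omega), h8]
      rfl
    · exact H _ (by rw [m₄, m₃, m]) (by rw [r₄, d₃]; rfl)

theorem wp_writeBlock (hnw : n ≤ 2 ^ w) {V : ℕ → Fin 4 → BitVec w} {i : ℕ} {v : BitVec w}
    (hi : i < n)
    (h1 : (s.regs 1).toNat = i) (hv : s.regs 2 = v) (h3 : (s.regs 3).toNat = N)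
    (h7 : (s.regs 7).toNat = i / 4) (h8 : (s.regs 8).toNat = i % 4)
    (h6 : (s.regs 6).toNat = N - 1) (hN : 4 * N < n) (hiN : i / 4 < N) (hbit : s.mem.bit = false)
    (hb : b < N) (hR : Rep N b Δ s.mem.word V) (hwb : (s.mem.word (N - 1) 1).toNat = b)
    (hwΔ : s.mem.word (N - 1) 2 = Δ)
    (H : ∀ s' : State n w, ∀ V',
      V' = Function.update V (i / 4) (Function.update (V (i / 4)) (Fin.ofNat 4 i) v) →
      (s'.mem.bit = true ∧ V' = s'.mem.word ∨
        s'.mem.bit = false ∧ ∃ b < N, Rep N b Δ s'.mem.word V' ∧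
          (s'.mem.word (N - 1) 1).toNat = b ∧ s'.mem.word (N - 1) 2 = Δ) → Q s') :
    wp writeBlock Q s := by
  have hw : 3 ≤ w := three_le_of_lt hnw (by omega)
  have hNw : N ≤ 2 ^ w := by omega
  have hci : 4 * (i / 4) + (Fin.ofNat 4 i : ℕ) = i := by simp only [Fin.ofNat]; omega
  rw [writeBlock, wp_seq]
  refine wp_getWord hw hnw (by omega) h6 (by simp; omega) fun s₁ m₁ r₁ f₁ => ?_
  rw [wp_seq]
  refine wp_getWord hw hnw (by omega) (by rw [f₁ 6 (by omega) (by omega), h6]) (by simp; omega)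
    fun s₂ m₂ r₂ f₂ => ?_
  have f : ∀ r < 30, r ≠ 4 → r ≠ 5 → s₂.regs r = s.regs r := fun r hr h4 h5 => by
    rw [f₂ r hr h5, f₁ r hr h4]
  have m : s₂.mem = s.mem := by rw [m₂, m₁]
  have h : Context N b Δ s₂ := ⟨hw, hnw, hN, hb.le,
    by rw [f 3 (by omega) (by omega) (by omega), h3],
    by rw [f₂ 4 (by omega) (by omega), r₁, hwb], by rw [r₂, m₁, hwΔ]⟩
  rw [← m] at hR
  rw [wp_seq]
  refine wp_extend h hb hR fun s₃ b₃ c₃ R₃ w₃ p₃ l₃ V₃ f₃ => ?_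
  have g : ∀ r < 10, r ≠ 4 → r ≠ 5 → s₃.regs r = s.regs r := fun r hr h4 h5 => by
    rw [f₃ r hr h4, f r (by omega) h4 h5]
  have e7 : (s₃.regs 7).toNat = i / 4 := by rw [g 7 (by omega) (by omega) (by omega), h7]
  have e8 : (s₃.regs 8).toNat = (Fin.ofNat 4 i : ℕ) := by
    rw [g 8 (by omega) (by omega) (by omega), h8]; rfl
  rw [wp_branch]
  simp only [Test.holds, eq_iff_toNat, c₃.reg3, c₃.reg4]
  refine ⟨fun hbN => ?_, fun hbN => ?_⟩
  -- The last block has become plain, so the array is stored as it is and the write is a single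
  -- store.
  · rw [wp_seq, wp_const, wp_seq, wp_putBit]
    have e1 : (s₃.regs 1).toNat = 4 * (i / 4) + (Fin.ofNat 4 i : ℕ) := by
      rw [g 1 (by omega) (by omega) (by omega), h1, hci]
    refine wp_store (k := i / 4) (c := Fin.ofNat 4 i) (by simpa [hci] using e1) (by omega)
      fun s₄ g₄ b₄ m₄ => ?_
    refine H s₄ _ rfl (Or.inl ⟨?_, ?_⟩)
    · rw [b₄]; simp; omega
    · rw [hbN] at R₃
      rw [m₄, R₃.eq]
      simp only [setReg_regs]
      norm_num [g 2, hv]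
      rfl
  · have hbN' : b + 1 < N := by omega
    rw [wp_seq]
    refine wp_putWord hw hnw (by omega) (by omega)
      (by rw [g 6 (by omega) (by omega) (by omega), h6]) (by simp; omega)
      fun s₄ b₄ m₄ f₄ => ?_
    have c₄ : Context N (b + 1) Δ s₄ := c₃.of_regs (f₄ 3 (by omega)) (f₄ 4 (by omega))
      (f₄ 5 (by omega))
    have hw1 : (s₄.mem.word (N - 1) 1).toNat = b + 1 := by
      rw [m₄]; simp [c₃.reg4]
    have hw2 : s₄.mem.word (N - 1) 2 = Δ := by
      rw [m₄]; simp [w₃ hbN', m, hwΔ]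
    have hsame : ∀ k c, (k = N - 1 → c ≠ 1) → s₄.mem.word k c = s₃.mem.word k c := by
      intro k c hkc
      rw [m₄, Function.update_apply]
      split_ifs with hk
      · subst hk; rw [Function.update_of_ne (hkc rfl)]
      · rfl
    -- Since `b + 1 < N`, the last block is still on the right, and its word 1, where the boundary
    -- is stored, carries neither data nor a pointer.
    have R₄ : Rep N (b + 1) Δ s₄.mem.word V := by
      refine R₃.congr hbN'.le (fun k _ c hkc => hsame k c fun hk => ?_) (fun _ _ => rfl)
        fun k hk => ?_
      · exact (hkc (by omega)).1
      · rw [R₃.tail k hk]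
        ext1 c
        rw [hsame k c (by omega)]
    have l₄ : ∀ j, ¬ Link N (b + 1) s₄.mem.word (s₃.regs 15).toNat j := by
      rintro j ⟨k1, k2, k3, k4, k5⟩
      rw [hsame _ _ (by simp)] at k4 k5
      exact l₃ j ⟨k1, k2, k3, k4, k5⟩
    have bit₄ : s₄.mem.bit = false := by rw [b₄, b₃, m, hbit]
    have e7' : (s₄.regs 7).toNat = i / 4 := by rw [f₄ 7 (by omega), e7]
    have e8' : (s₄.regs 8).toNat = (Fin.ofNat 4 i : ℕ) := by rw [f₄ 8 (by omega), e8]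
    have e2' : s₄.regs 2 = v := by
      rw [f₄ 2 (by omega), g 2 (by omega) (by omega) (by omega), hv]
    rw [wp_branch]
    simp only [Test.holds, e7', c₄.reg4]
    refine ⟨fun hlt => ?_, fun hlt => ?_⟩
    · rw [wp_seq]
      refine wp_relocate c₄ R₄ (f := (s₃.regs 15).toNat) e7' (by rw [f₄ 15 (by omega)]) hlt p₃
        hbN' l₄ V₃ fun s₅ b₅ R₅ l₅ w₅ f₅ => ?_
      have c₅ : Context N (b + 1) Δ s₅ := c₄.of_regs (f₅ 3 (by omega)) (f₅ 4 (by omega))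
        (f₅ 5 (by omega))
      rw [wp_seq]
      refine wp_loadPlain c₅ (by omega) (by rw [f₅ 7 (by omega), e7']) hiN
        fun s₆ m₆ d₆ f₆ => ?_
      rw [wp_seq]
      refine wp_changeWord hw (c := Fin.ofNat 4 i)
        (by rw [f₆ 8 (by omega) (by omega), f₅ 8 (by omega), e8']) fun s₇ m₇ d₇ f₇ => ?_
      have f' : ∀ r < 10, s₇.regs r = s₅.regs r := fun r hr => by
        rw [f₇ r (by omega) (by omega), f₆ r (by omega) (by omega)]
      have c₇ : Context N (b + 1) Δ s₇ := c₅.of_regs (f' 3 (by omega)) (f' 4 (by omega))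
        (f' 5 (by omega))
      refine wp_plainBlock c₇ (by omega) (by omega) (by omega) (by omega) (by omega)
        (by rw [f' 7 (by omega), f₅ 7 (by omega), e7']) hlt fun s₈ b₈ m₈ f₈ => ?_
      have hd : ![s₇.regs 10, s₇.regs 11, s₇.regs 12, s₇.regs 13] =
          Function.update (V (i / 4)) (Fin.ofNat 4 i) v := by
        rw [← State.data, d₇, d₆, f₆ 2 (by omega) (by omega), f₅ 2 (by omega), e2',
          R₅.left_free _ hlt l₅]
      rw [hd, m₇, m₆] at m₈
      refine H s₈ _ rfl (Or.inr ⟨by rw [b₈, m₇, m₆, b₅, bit₄], b + 1, hbN', ?_, ?_, ?_⟩)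
      · rw [m₈]
        exact R₅.setPlain_free hlt hbN'.le l₅ _
      · rw [m₈, setPlain_of_ne (by omega) _ (by decide), w₅ 1 (Or.inl rfl), hw1]
      · rw [m₈, setPlain_of_ne (by omega) _ (by decide), w₅ 2 (Or.inr rfl), hw2]
    · rw [wp_seq]
      have hq : b + 1 ≤ i / 4 := by omega
      -- A partner that the target already has is given up; the target always gets the spare block
      -- instead.
      refine wp_detach c₄ R₄ (by omega) (by omega) (by omega) e7' hq hiN
        fun s₅ b₅ d₅ R₅ w₅ v₅ p₅ f₅ => ?_
      rw [wp_seq]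
      refine wp_changeWord hw (c := Fin.ofNat 4 i)
        (by rw [f₅ 8 (by omega) (by omega) (by omega), e8']) fun s₆ m₆ d₆ f₆ => ?_
      have f' : ∀ r < 20, r ≠ 16 → r < 10 ∨ 14 ≤ r → s₆.regs r = s₄.regs r :=
        fun r hr h1 h2 => by rw [f₆ r hr h2, f₅ r hr h1 h2]
      have c₆ : Context N (b + 1) Δ s₆ := c₄.of_regs (f' 3 (by omega) (by omega) (by omega))
        (f' 4 (by omega) (by omega) (by omega)) (f' 5 (by omega) (by omega) (by omega))
      refine wp_linkBlocks c₆ (i := (s₃.regs 15).toNat) (by omega) (by omega)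
        (by rw [f' 15 (by omega) (by omega) (by omega), f₄ 15 (by omega)])
        (by rw [f' 7 (by omega) (by omega) (by omega), e7']) p₃ hq hiN
        fun s₇ b₇ m₇ f₇ => ?_
      rw [d₆, d₅, m₆, f₅ 2 (by omega) (by omega) (by omega), e2'] at m₇
      refine H s₇ _ rfl (Or.inr ⟨by rw [b₇, m₆, b₅, bit₄], b + 1, hbN', ?_, ?_, ?_⟩)
      · rw [m₇]
        have := R₅.setLink p₃ hq hiN hNw (fun j hj => l₄ j (v₅ _ _ hj).1)
          (fun i hi => (v₅ _ _ hi).2 rfl)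
          (by rw [Function.update_of_ne (by omega), V₃])
          (Function.update (V (i / 4)) (Fin.ofNat 4 i) v)
        rwa [Function.update_idem] at this
      · rw [m₇, setLink_of_ne (by omega) _ (Or.inl rfl), w₅ _ (by omega) _ (by decide), hw1]
      · rw [m₇, setLink_of_ne (by omega) _ (Or.inr rfl), w₅ _ (by omega) _ (by decide), hw2]

end

/-! ### Whole operations and sequences of operations. -/

section

variable {n w : ℕ} {Q : State n w → Prop} {s : State n w}

theorem wp_dispatch_read (hw : 1 ≤ w) (hnw : n ≤ 2 ^ w) {m : Memory n w}
    {A : Fin n → BitVec w} (hA : Represents m A) (i : Fin n) :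
    wp (dispatch readBlock (.load 0 1)) (fun s => s.mem = m ∧ s.regs 0 = A i)
      (startState m (BitVec.ofNat w i) 0) := by
  have hi := i.isLt
  have ei : (BitVec.ofNat w i).toNat = i := by
    rw [BitVec.toNat_ofNat, Nat.mod_eq_of_lt (by omega)]
  have hci : 4 * (i / 4 : ℕ) + (Fin.ofNat 4 i : ℕ) = i := by simp only [Fin.ofNat]; omega
  obtain ⟨V, hV, ht, hf⟩ := hA
  rw [dispatch, wp_seq]
  refine wp_prologue (by omega) hw hnw m _ _ fun s m₁ r0 r1 _ r3 r7 r8 r6 _ r22 _ => ?_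
  rw [ei] at r7 r8
  have load : V (i / 4) = m.word (i / 4) →
      wp (.instr (.load 0 1)) (fun s => s.mem = m ∧ s.regs 0 = A i) s := by
    intro h
    rw [wp_load (k := i / 4) (c := Fin.ofNat 4 i) (by rw [r1, ei, hci]) (by omega)]
    refine ⟨by rw [setReg_mem, m₁], ?_⟩
    rw [hV, entry, h, setReg_regs, if_pos rfl, m₁]
  rw [wp_branch]
  simp only [Test.holds, r22]
  refine ⟨fun hb => ?_, fun hb => load (by rw [ht (by simpa using hb)])⟩
  obtain ⟨b, Δ, hbN, hR, hh⟩ := hf hb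
  rw [wp_branch]
  simp only [Test.holds, r3, r7]
  refine ⟨fun hlt => ?_, fun hlt => load (hR.tail _ (by omega))⟩
  obtain ⟨hb', h1, h2⟩ := hh (by omega)
  rw [← m₁] at hR h1 h2
  refine wp_readBlock hnw hi (by rw [r1, ei]) r3 r7 r8 (r6 (by omega)) (by omega) hlt hb' hR h1 h2
    fun s' m' r' => ⟨by rw [m', m₁], by rw [r', hV]⟩

theorem wp_dispatch_write (hw : 1 ≤ w) (hnw : n ≤ 2 ^ w) {m : Memory n w}
    {A : Fin n → BitVec w} (hA : Represents m A) (i : Fin n) (v : BitVec w) :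
    wp (dispatch writeBlock (.store 1 2)) (fun s => Represents s.mem (Function.update A i v))
      (startState m (BitVec.ofNat w i) v) := by
  have hi := i.isLt
  have ei : (BitVec.ofNat w i).toNat = i := by
    rw [BitVec.toNat_ofNat, Nat.mod_eq_of_lt (by omega)]
  have hci : 4 * (i / 4 : ℕ) + (Fin.ofNat 4 i : ℕ) = i := by simp only [Fin.ofNat]; omega
  obtain ⟨V, hV, ht, hf⟩ := hA
  rw [dispatch, wp_seq]
  refine wp_prologue (by omega) hw hnw m _ _ fun s m₁ r0 r1 r2 r3 r7 r8 r6 _ r22 _ => ?_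
  rw [ei] at r7 r8
  rw [wp_branch]
  simp only [Test.holds, r22]
  refine ⟨fun hb => ?_, fun hb => ?_⟩
  · obtain ⟨b, Δ, hbN, hR, hh⟩ := hf hb
    rw [wp_branch]
    simp only [Test.holds, r3, r7]
    refine ⟨fun hlt => ?_, fun hlt => ?_⟩
    · obtain ⟨hb', h1, h2⟩ := hh (by omega)
      rw [← m₁] at hR h1 h2 hb
      refine wp_writeBlock hnw hi (by rw [r1, ei]) r2 r3 r7 r8 (r6 (by omega)) (by omega) hlt hb hb'
        hR h1 h2 fun s' V' hV' h' => ⟨V', ?_, ?_, ?_⟩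
      · intro k
        rw [hV', entry_update hV]
      · intro hbit
        obtain ⟨-, h⟩ | ⟨h, -⟩ := h'
        · exact h
        · rw [h] at hbit; cases hbit
      · intro hbit
        obtain ⟨h, -⟩ | ⟨-, b', k1, k2, k3, k4⟩ := h'
        · rw [h] at hbit; cases hbit
        · exact ⟨b', Δ, k1.le, k2, fun _ => ⟨k1, k3, k4⟩⟩
    · refine wp_store (k := i / 4) (c := Fin.ofNat 4 i) (by rw [r1, ei, hci]) (by omega)
        fun s' g' b' m' => ⟨_, entry_update hV i v, ?_, ?_⟩
      · intro hbit
        rw [b', m₁, hb] at hbit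
        cases hbit
      · intro _
        rw [m', m₁, r2, ← hR.tail _ (by omega)]
        refine ⟨b, Δ, hbN, hR.update_tail hbN (by omega) _, fun hN => ?_⟩
        rw [Function.update_of_ne (by omega)]
        exact hh hN
  · refine wp_store (k := i / 4) (c := Fin.ofNat 4 i) (by rw [r1, ei, hci]) (by omega)
      fun s' g' b' m' => ⟨_, entry_update hV i v, ?_, ?_⟩
    · intro _
      rw [m', m₁, r2, ht (by simpa using hb)]
    · intro hbit
      rw [b', m₁] at hbit
      exact absurd hbit hb

/-- The literal `c` may wrap around. Then some cell beyond the blocks may be filled once more, which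
is harmless; an offset whose cell exists is less than `2 ^ w` and does not wrap. -/
theorem wp_fillTail (hn : 1 ≤ n) (hnw : n ≤ 2 ^ w) (c : Fin 4) {v : BitVec w}
    (h2 : s.regs 2 = v) (h24 : (s.regs 24).toNat = (n - 1) % 4)
    (h25 : (s.regs 25).toNat = 4 * ((n - 1) / 4))
    (H : ∀ s' : State n w, (∀ r < 26, s'.regs r = s.regs r) →
      (∀ d : Fin 4, 4 * ((n - 1) / 4) + (d : ℕ) < n → d = c ∨ s.mem.word ((n - 1) / 4) d = v →
        s'.mem.word ((n - 1) / 4) d = v) → Q s') :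
    wp (fillTail c) Q s := by
  rw [fillTail, wp_seq, wp_const, wp_branch]
  simp only [Test.holds, setReg_regs]
  norm_num [h24]
  have hc : (c : ℕ) % 2 ^ w ≤ c := Nat.mod_le _ _
  have hc4 := c.isLt
  refine ⟨fun hlt => ?_, fun hlt => ?_⟩
  · refine wp_skip fun s' m' f' => H s' (fun r hr => ?_) ?_
    · rw [f' r (by omega)]; simp [show r ≠ 26 by omega]
    · rintro d hd (rfl | h)
      · rw [Nat.mod_eq_of_lt (by omega)] at hlt
        omega
      · rw [m', setReg_mem, h]
  · rw [wp_seq, wp_binop]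
    have ec : ((Fin.ofNat 4 ((c : ℕ) % 2 ^ w) : Fin 4) : ℕ) = (c : ℕ) % 2 ^ w :=
      Nat.mod_eq_of_lt (by omega)
    refine wp_store (k := (n - 1) / 4) (c := Fin.ofNat 4 ((c : ℕ) % 2 ^ w)) ?_ (by omega)
      fun s' g' b' m' => H s' (fun r hr => ?_) ?_
    · rw [ec, setReg_regs, if_pos rfl]
      change (s.regs 25 + BitVec.ofNat w c).toNat = _
      rw [BitVec.toNat_add, BitVec.toNat_ofNat, h25, Nat.mod_eq_of_lt (by omega)]
    · rw [g']; simp [show r ≠ 26 by omega, show r ≠ 27 by omega]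
    · intro d hd h
      rw [m', Function.update_self, Function.update_apply]
      split_ifs with hdc
      · simp [h2]
      · obtain rfl | h := h
        · refine absurd (Fin.ext ?_) hdc
          rw [ec, Nat.mod_eq_of_lt (by omega)]
        · exact h

/-- Nothing is assumed about `m`, so this covers the initialization as well. With boundary `0` there
are no left blocks, hence no links, and the old contents of the blocks are ignored. -/
theorem wp_fillProgram (hn : 1 ≤ n) (hw : 1 ≤ w) (hnw : n ≤ 2 ^ w) (m : Memory n w)
    (i v : BitVec w) :
    wp fillProgram (fun s => Represents s.mem fun _ => v) (startState m i v) := by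
  rw [fillProgram, wp_seq]
  refine wp_prologue hn hw hnw m _ _ fun s m₁ r0 r1 r2 r3 r7 r8 r6 r20 _ r23 => ?_
  rw [wp_seq, wp_binop, wp_seq, wp_binop]
  generalize hs₁ : State.setReg _ _ _ = s₁
  have f₁ : ∀ r < 24, s₁.regs r = s.regs r := fun r hr => by
    rw [← hs₁]; simp [show r ≠ 24 by omega, show r ≠ 25 by omega]
  have e24 : (s₁.regs 24).toNat = (n - 1) % 4 := by
    rw [← hs₁]
    simp [BinOp.eval, r0, r20, mod_four_mod_two_pow hw (show n - 1 < 2 ^ w by omega)]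
  have e25 : (s₁.regs 25).toNat = 4 * ((n - 1) / 4) := by
    rw [← hs₁]
    simp only [setReg_regs]
    norm_num [BinOp.eval, r20, r3, BitVec.toNat_mul]
    rw [Nat.mod_eq_of_lt (by omega)]
  rw [wp_seq]
  refine wp_fillTail hn hnw 0 (by rw [f₁ 2 (by omega), r2]) e24 e25 fun s₂ f₂ w₂ => ?_
  rw [wp_seq]
  refine wp_fillTail hn hnw 1 (by rw [f₂ 2 (by omega), f₁ 2 (by omega), r2])
    (by rw [f₂ 24 (by omega), e24]) (by rw [f₂ 25 (by omega), e25]) fun s₃ f₃ w₃ => ?_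
  rw [wp_seq]
  refine wp_fillTail hn hnw 2 (by rw [f₃ 2 (by omega), f₂ 2 (by omega), f₁ 2 (by omega), r2])
    (by rw [f₃ 24 (by omega), f₂ 24 (by omega), e24])
    (by rw [f₃ 25 (by omega), f₂ 25 (by omega), e25]) fun s₄ f₄ w₄ => ?_
  rw [wp_seq]
  refine wp_fillTail hn hnw 3
    (by rw [f₄ 2 (by omega), f₃ 2 (by omega), f₂ 2 (by omega), f₁ 2 (by omega), r2])
    (by rw [f₄ 24 (by omega), f₃ 24 (by omega), f₂ 24 (by omega), e24])
    (by rw [f₄ 25 (by omega), f₃ 25 (by omega), f₂ 25 (by omega), e25]) fun s₅ f₅ w₅ => ?_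
  have f : ∀ r < 24, s₅.regs r = s.regs r := fun r hr => by
    rw [f₅ r (by omega), f₄ r (by omega), f₃ r (by omega), f₂ r (by omega), f₁ r hr]
  have tail : ∀ d : Fin 4, 4 * ((n - 1) / 4) + (d : ℕ) < n →
      s₅.mem.word ((n - 1) / 4) d = v := by
    intro d hd
    refine w₅ d hd ?_
    by_cases h3 : d = 3
    · exact Or.inl h3
    refine Or.inr (w₄ d hd ?_)
    by_cases h2 : d = 2
    · exact Or.inl h2
    refine Or.inr (w₃ d hd ?_)
    by_cases h1 : d = 1
    · exact Or.inl h1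
    refine Or.inr (w₂ d hd (Or.inl ?_))
    omega
  have hentry : ∀ k : Fin n, (n - 1) / 4 ≤ (k : ℕ) / 4 → v = entry s₅.mem.word k := by
    intro k hk
    have hk' := k.isLt
    have e : (k : ℕ) / 4 = (n - 1) / 4 := by omega
    rw [entry, e, tail]
    simp only [Fin.ofNat]
    omega
  rw [wp_branch]
  have e0 : (0 : BitVec w).toNat = 0 := BitVec.toNat_zero
  simp only [Test.holds, f 23 (by omega), f 3 (by omega), r23, r3, e0]
  refine ⟨fun hN => ?_, fun hN => ?_⟩
  · have hw3 := three_le_of_lt hnw hN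
    rw [wp_seq]
    refine wp_putWord hw3 hnw (by omega) (by omega) (by rw [f 6 (by omega), r6 hN])
      (by simp; omega) fun s₆ b₆ m₆ f₆ => ?_
    rw [wp_seq]
    refine wp_putWord hw3 hnw (by omega) (by omega)
      (by rw [f₆ 6 (by omega), f 6 (by omega), r6 hN])
      (by simp; omega) fun s₇ b₇ m₇ f₇ => ?_
    rw [wp_putBit]
    rw [f₆ 2 (by omega), f 2 (by omega), r2] at m₇
    rw [f 23 (by omega), r23] at m₆
    have e23 : s₇.regs 23 = 0 := by rw [f₇ 23 (by omega), f₆ 23 (by omega), f 23 (by omega), r23]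
    have hT : ∀ k, (n - 1) / 4 ≤ k → s₇.mem.word k = s₅.mem.word k := fun k hk => by
      rw [m₇, Function.update_of_ne (by omega), m₆, Function.update_of_ne (by omega)]
    refine ⟨fun k => if k < (n - 1) / 4 then fun _ => v else s₅.mem.word k, ?_, ?_, ?_⟩
    · intro k
      by_cases hk : (k : ℕ) / 4 < (n - 1) / 4
      · simp [entry, hk]
      · rw [hentry k (by omega)]
        simp only [entry, if_neg hk]
    · intro hbit
      simp [e23] at hbit
    · intro _
      refine ⟨0, v, by omega, Rep.fill ?_ ?_, fun _ => ⟨hN, ?_, ?_⟩⟩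
      · intro k hk
        simp [hk]
      · intro k hk
        rw [if_neg (by omega)]
        exact (hT k hk).symm
      · change (s₇.mem.word _ _).toNat = 0
        rw [m₇, m₆]
        simp
      · change s₇.mem.word _ _ = v
        rw [m₇]
        simp
  -- Without blocks the bit keeps its old value; both values represent the same array.
  · refine wp_skip fun s₆ m₆ f₆ => ?_
    rw [m₆]
    refine ⟨s₅.mem.word, fun k => hentry k (by omega), fun _ => rfl, fun _ => ?_⟩
    exact ⟨0, v, by omega, Rep.fill (fun k hk => by omega) fun _ _ => rfl, fun h => absurd h hN⟩

/-- The array after an operation. -/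
def Operation.applyTotal : Operation n w → (Fin n → BitVec w) → (Fin n → BitVec w)
  | .read _, A => A
  | .write i v, A => Function.update A i v
  | .fill v, _ => fun _ => v

theorem wp_operation (hn : 1 ≤ n) (hw : 1 ≤ w) (hnw : n ≤ 2 ^ w) {m : Memory n w}
    {A : Fin n → BitVec w} (hA : Represents m A) (op : Operation n w) :
    wp (implementation.program op)
      (fun s => Represents s.mem (op.applyTotal A) ∧ ∀ i, op = .read i → s.regs 0 = A i)
      (op.start m) := by
  cases op with
  | read i =>
    refine wp_mono _ (wp_dispatch_read hw hnw hA i) fun s hs => ⟨?_, ?_⟩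
    · rw [hs.1]; exact hA
    · intro i' hi'
      cases hi'
      exact hs.2
  | write i v =>
    refine wp_mono _ (wp_dispatch_write hw hnw hA i v) fun s hs => ⟨hs, ?_⟩
    intro i' hi'
    cases hi'
  | fill v =>
    refine wp_mono _ (wp_fillProgram hn hw hnw m 0 v) fun s hs => ⟨hs, ?_⟩
    intro i' hi'
    cases hi'

/-- A bound on the size of all programs of an implementation. -/
def Implementation.size (D : Implementation) : ℕ :=
  D.init.size + D.read.size + D.write.size + D.fill.size

theorem Implementation.size_program_le (D : Implementation) (op : Operation n w) :
    (D.program op).size ≤ D.size := by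
  cases op <;> simp only [Implementation.program, Implementation.size] <;> omega

/-- The memory represents a total array, which also has values at entries never set; it suffices
that it agrees with the partial array wherever the latter is defined. -/
theorem Operation.apply_le_applyTotal (op : Operation n w) {A : Fin n → BitVec w}
    {A' : Fin n → Option (BitVec w)} (h : ∀ i v, A' i = some v → A i = v) (i : Fin n)
    (v : BitVec w) (hv : op.apply A' i = some v) : op.applyTotal A i = v := by
  cases op with
  | read j => exact h i v hv
  | write j Δ =>
    simp only [Operation.apply, Operation.applyTotal, Function.update_apply] at hv ⊢
    split_ifs at hv ⊢ with hij
    · exact Option.some.inj hv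
    · exact h i v hv
  | fill Δ => exact Option.some.inj hv

theorem exists_run (hn : 1 ≤ n) (hw : 1 ≤ w) (hnw : n ≤ 2 ^ w) (ops : List (Operation n w))
    {m : Memory n w} {A : Fin n → BitVec w} (hA : Represents m A)
    {A' : Fin n → Option (BitVec w)} (h : ∀ i v, A' i = some v → A i = v) :
    ∃ (es : List (Event n w)) (m' : Memory n w), implementation.Run m es m' ∧
      es.map Event.op = ops ∧ Correct A' es ∧ ∀ e ∈ es, e.time ≤ implementation.size := by
  induction ops generalizing m A A' with
  | nil => exact ⟨[], m, .nil, rfl, trivial, by simp⟩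
  | cons op ops ih =>
    obtain ⟨t, s, hE, ht, hs, hr⟩ := exists_exec_of_wp _ (wp_operation hn hw hnw hA op)
    obtain ⟨es, m', h1, h2, h3, h4⟩ := ih hs (op.apply_le_applyTotal h)
    refine ⟨⟨op, s.regs 0, t⟩ :: es, m', .cons hE h1, by simp [h2], ⟨?_, h3⟩, ?_⟩
    · intro i v hi hv
      exact (hr i hi).trans (h i v hv)
    · rintro e (_ | ⟨_, he⟩)
      · exact ht.trans (implementation.size_program_le op)
      · exact h4 e he

/-- The amortized bound is obtained from a worst-case bound on every single write. -/
theorem writeTime_le {C : ℕ} (es : List (Event n w)) (h : ∀ e ∈ es, e.time ≤ C) :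
    writeTime es ≤ C * numWrites es := by
  rw [writeTime, numWrites, List.countP_eq_length_filter, mul_comm]
  have := List.sum_le_card_nsmul ((es.filter fun e => e.op.isWrite).map Event.time) C
    (by
      intro t ht
      obtain ⟨e, he, rfl⟩ := List.mem_map.1 ht
      exact h e (List.mem_filter.1 he).1)
  simpa using this

end

end FillableArray

theorem theorem1 :
    ∃ (D : FillableArray.Implementation) (C : ℕ),
      ∀ n w : ℕ, 1 ≤ n → 1 ≤ w → n ≤ 2 ^ w →
        ∀ m₀ : FillableArray.Memory n w,
          ∃ (t₀ : ℕ) (m : FillableArray.Memory n w),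
            D.InitExec m₀ t₀ m ∧ t₀ ≤ C ∧
            ∀ ops : List (FillableArray.Operation n w),
              ∃ (es : List (FillableArray.Event n w)) (m' : FillableArray.Memory n w),
                D.Run m es m' ∧
                es.map FillableArray.Event.op = ops ∧
                FillableArray.Correct (fun _ => none) es ∧
                (∀ e ∈ es, e.op.isWrite = false → e.time ≤ C) ∧
                FillableArray.writeTime es ≤ C * FillableArray.numWrites es := by
  refine ⟨FillableArray.implementation, FillableArray.implementation.size, ?_⟩
  intro n w hn hw hnw m₀
  -- The initialization is a fill with `0`.
  obtain ⟨t, s, hE, ht, hs⟩ :=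
    FillableArray.exists_exec_of_wp _ (FillableArray.wp_fillProgram hn hw hnw m₀ 0 0)
  refine ⟨t, s.mem, ⟨s, hE, rfl⟩, ?_, fun ops => ?_⟩
  · refine ht.trans ?_
    change _ ≤ FillableArray.fillProgram.size + _ + _ + _
    omega
  · obtain ⟨es, m', h1, h2, h3, h4⟩ := FillableArray.exists_run hn hw hnw ops hs
      (A' := fun _ => none) (fun _ _ h => nomatch h)
    exact ⟨es, m', h1, h2, h3, fun e he _ => h4 e he, FillableArray.writeTime_le es h4⟩
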